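/- **Setting.** An *almost hypercomplex manifold with Hermitian and Norden metrics* is a smooth $4n$-dimensional manifold with smooth almost complex structures $J_1,J_2,J_3$ satisfying $J_\alpha=J_\beta J_\gamma=-J_\gamma J_\beta$ for all cyclic permutations $(\alpha,\beta,\gamma)$ of $(1,2,3)$, and with a pseudo-Riemannian metric $g$ such that $g(J_1X,J_1Y)=-g(J_2X,J_2Y)=-g(J_3X,J_3Y)=g(X,Y)$. Let $\nabla$ be the Levi-Civita connection of $g$, $F_\alpha(X,Y,Z)=g((\nabla_XJ_\alpha)Y,Z)$ the fundamental tensors, and $\theta_\alpha(Z)=g^{ij}F_\alpha(e_i,e_j,Z)$ (for any basis $(e_i)$ of the tangent space) the Lee forms. The manifold is a *$\mathcal W$-manifold* if the Nijenhuis tensors of $J_1,J_2,J_3$ vanish and $$F_1(X,Y,Z)=\tfrac{1}{2(2n-1)}\big[g(X,Y)\theta_1(Z)-g(X,Z)\theta_1(Y)-g(X,J_1Y)\theta_1(J_1Z)+g(X,J_1Z)\theta_1(J_1Y)\big],$$ $$F_\alpha(X,Y,Z)=\tfrac{1}{4n}\big[g(X,Y)\theta_\alpha(Z)+g(X,Z)\theta_\alpha(Y)+g(X,J_\alpha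 Y)\theta_\alpha(J_\alpha Z)+g(X,J_\alpha Z)\theta_\alpha(J_\alpha Y)\big]\quad(\alpha=2,3).$$ It is a *$\mathcal K$-manifold* if $\nabla J_\alpha=0$ for $\alpha=1,2,3$; every $\mathcal K$-manifold is a $\mathcal W$-manifold. A $4m$-dimensional (immersed) submanifold $M$ of a $4n$-dimensional such manifold $\overline M$, $m<n$, is *holomorphic* if $J_\alpha(T_pM)=T_pM$ for all $p\in M$ and $\alpha=1,2,3$, and $g$ restricted to each $T_pM$ is nondegenerate; it carries the restrictions of $g$ and $J_\alpha$. **Theorem.** Let $M$ be a $4m$-dimensional holomorphic submanifold of a $4n$-dimensional $\mathcal W$-manifold $\overline M$, $m<n$, and let $\theta_\alpha$ and $\overline\theta_\alpha$ be the Lee forms of $M$ and of $\overline M$. Then $M$ satisfies the defining conditions of a $\mathcal W$-manifold, and: 1. $M$ is a $\mathcal W$-manifold that is not a $\mathcal K$-manifold if and only if all $\overline\theta_\alpha$ ($\alpha=1,2,3$) are non-zero on $TM$, that is, none of $\overline\theta_1,\overline\theta_2,\overline\theta_3$ vanishes identically on $TM$. 2. $M$ is a $\mathcal K$-manifold if and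 only if all $\overline\theta_\alpha$ ($\alpha=1,2,3$) vanish identically on $TM$. 3. On $TM$ the Lee forms are related by $\theta_1=\frac{2m-1}{2n-1}\,\overline\theta_1$ and $\theta_\alpha=\frac mn\,\overline\theta_\alpha$ for $\alpha=2,3$. -/

import Mathlib

open Bundle VectorField
open scoped Manifold ContDiff

noncomputable section

section Metric

variable (E : Type*) [NormedAddCommGroup E] [NormedSpace ℝ E]
  (M : Type*) [TopologicalSpace M] [ChartedSpace E M] [IsManifold 𝓘(ℝ, E) ∞ M]

/-- A smooth pseudo-Riemannian metric on a smooth manifold `M` modelled on `E`: a smooth symmetric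
and nondegenerate covariant 2-tensor field, given as a smooth section of `Hom(TM, Hom(TM, ℝ))`. -/
structure PseudoRiemannianMetric where
  val (x : M) : TangentSpace 𝓘(ℝ, E) x →L[ℝ] TangentSpace 𝓘(ℝ, E) x →L[ℝ] ℝ
  symm (x : M) (u v : TangentSpace 𝓘(ℝ, E) x) : val x u v = val x v u
  nondegenerate (x : M) (u : TangentSpace 𝓘(ℝ, E) x) (hu : ∀ v, val x u v = 0) : u = 0
  contMDiff : ContMDiff 𝓘(ℝ, E) (𝓘(ℝ, E).prod 𝓘(ℝ, E →L[ℝ] E →L[ℝ] ℝ)) ∞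
    (fun x : M ↦ TotalSpace.mk' (E →L[ℝ] E →L[ℝ] ℝ)
      (E := fun x : M ↦ TangentSpace 𝓘(ℝ, E) x →L[ℝ] TangentSpace 𝓘(ℝ, E) x →L[ℝ] ℝ) x (val x))

end Metric

variable {E : Type*} [NormedAddCommGroup E] [NormedSpace ℝ E] [FiniteDimensional ℝ E]
  {M : Type*} [TopologicalSpace M] [ChartedSpace E M] [IsManifold 𝓘(ℝ, E) ∞ M]

instance tangentSpace_finiteDimensional (x : M) :
    FiniteDimensional ℝ (TangentSpace 𝓘(ℝ, E) x) :=
  inferInstanceAs (FiniteDimensional ℝ E)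

namespace PseudoRiemannianMetric

variable (g : PseudoRiemannianMetric E M)

variable {g} in
theorem mdifferentiableAt_apply {X Y : Π x : M, TangentSpace 𝓘(ℝ, E) x} {x : M}
    (hX : MDiffAt (T% X) x) (hY : MDiffAt (T% Y) x) :
    MDiffAt (fun y ↦ g.val y (X y) (Y y)) x := by
  have : MDifferentiableAt 𝓘(ℝ, E) (𝓘(ℝ, E).prod 𝓘(ℝ))
      (fun m ↦ TotalSpace.mk' ℝ (E := Bundle.Trivial M ℝ) m (g.val m (X m) (Y m))) x := by
    apply MDifferentiableAt.clm_bundle_apply₂ (F₁ := E) (F₂ := E)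
    · exact g.contMDiff.contMDiffAt.mdifferentiableAt (by simp)
    · exact hX
    · exact hY
  simp only [mdifferentiableAt_totalSpace] at this
  exact this.2

/-- The affine connection `D` is a Levi-Civita connection of `g`: it is torsion-free,
`∇_X Y - ∇_Y X = [X, Y]`, and metric, `v g(Y, Z) = g(∇_v Y, Z) + g(Y, ∇_v Z)`.
In Mathlib, `∇_X Y` at `x` is written `D Y x (X x)`. -/
structure IsLeviCivita (D : CovariantDerivative 𝓘(ℝ, E) E (TangentSpace 𝓘(ℝ, E) : M → Type _)) :
    Prop where
  torsion_free {X Y : Π x : M, TangentSpace 𝓘(ℝ, E) x} {x : M}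
    (hX : MDiffAt (T% X) x) (hY : MDiffAt (T% Y) x) :
    D Y x (X x) - D X x (Y x) = mlieBracket 𝓘(ℝ, E) X Y x
  metric {Y Z : Π x : M, TangentSpace 𝓘(ℝ, E) x} {x : M}
    (hY : MDiffAt (T% Y) x) (hZ : MDiffAt (T% Z) x) (v : TangentSpace 𝓘(ℝ, E) x) :
    d% (fun y ↦ g.val y (Y y) (Z y)) x v = g.val x (D Y x v) (Z x) + g.val x (Y x) (D Z x v)

/-- The right-hand side of the Koszul formula for `2 g(∇_X Y, Z)`. -/
def koszul (X Y Z : Π x : M, TangentSpace 𝓘(ℝ, E) x) (x : M) : ℝ :=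
  d% (fun y ↦ g.val y (Y y) (Z y)) x (X x) + d% (fun y ↦ g.val y (Z y) (X y)) x (Y x)
    - d% (fun y ↦ g.val y (X y) (Y y)) x (Z x)
    + g.val x (mlieBracket 𝓘(ℝ, E) X Y x) (Z x) - g.val x (mlieBracket 𝓘(ℝ, E) Y Z x) (X x)
    + g.val x (mlieBracket 𝓘(ℝ, E) Z X x) (Y x)

variable {g} in
theorem d_add_left {X X' Y : Π x : M, TangentSpace 𝓘(ℝ, E) x} {x : M}
    (hX : MDiffAt (T% X) x) (hX' : MDiffAt (T% X') x) (hY : MDiffAt (T% Y) x) :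
    d% (fun y ↦ g.val y ((X + X') y) (Y y)) x =
      d% (fun y ↦ g.val y (X y) (Y y)) x + d% (fun y ↦ g.val y (X' y) (Y y)) x := by
  rw [← mvfderiv_add (mdifferentiableAt_apply hX hY) (mdifferentiableAt_apply hX' hY)]
  congr 1
  ext y
  simp

variable {g} in
theorem d_smul_left {X Y : Π x : M, TangentSpace 𝓘(ℝ, E) x} {x : M} {f : M → ℝ}
    (hf : MDiffAt f x) (hX : MDiffAt (T% X) x) (hY : MDiffAt (T% Y) x) (v : TangentSpace 𝓘(ℝ, E) x) :
    d% (fun y ↦ g.val y ((f • X) y) (Y y)) x v =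
      d% f x v * g.val x (X x) (Y x) + f x * d% (fun y ↦ g.val y (X y) (Y y)) x v := by
  have := mvfderiv_mul hf (mdifferentiableAt_apply (g := g) hX hY)
  have h2 : (fun y ↦ g.val y ((f • X) y) (Y y)) = f * (fun y ↦ g.val y (X y) (Y y)) := by
    ext y; simp
  rw [h2, this]
  simp
  ring

theorem d_symm (X Y : Π x : M, TangentSpace 𝓘(ℝ, E) x) (x : M) :
    d% (fun y ↦ g.val y (X y) (Y y)) x = d% (fun y ↦ g.val y (Y y) (X y)) x := by
  congr 1; ext y; exact g.symm ..

theorem tensorial₁ {Y Z : Π x : M, TangentSpace 𝓘(ℝ, E) x} {x : M}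
    (hY : MDiffAt (T% Y) x) (hZ : MDiffAt (T% Z) x) :
    TensorialAt 𝓘(ℝ, E) E (fun X ↦ g.koszul X Y Z x) x where
  smul {f X} hf hX := by
    simp only [koszul]
    rw [d_symm g Z (f • X), d_smul_left hf hX hY, d_smul_left hf hX hZ,
      mlieBracket_smul_left hf hX, mlieBracket_smul_right hf hX, d_symm g Z X]
    simp
    ring
  add {X X'} hX hX' := by
    simp only [koszul]
    rw [d_symm g Z (X + X'), d_add_left hX hX' hY, d_add_left hX hX' hZ,
      mlieBracket_add_left hX hX', mlieBracket_add_right hX hX', d_symm g Z X, d_symm g Z X']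
    simp
    ring

theorem tensorial₂ {X Y : Π x : M, TangentSpace 𝓘(ℝ, E) x} {x : M}
    (hX : MDiffAt (T% X) x) (hY : MDiffAt (T% Y) x)  :
    TensorialAt 𝓘(ℝ, E) E (fun Z ↦ g.koszul X Y Z x) x where
  smul {f Z} hf hZ := by
    simp only [koszul]
    rw [d_symm g Y (f • Z), d_smul_left hf hZ hY, d_smul_left hf hZ hX,
      mlieBracket_smul_left hf hZ, mlieBracket_smul_right hf hZ, d_symm g Y Z]
    simp
    rw [g.symm x (Z x) (X x)]
    ring
  add {Z Z'} hZ hZ' := by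
    simp only [koszul]
    rw [d_symm g Y (Z + Z'), d_add_left hZ hZ' hY, d_add_left hZ hZ' hX,
      mlieBracket_add_left hZ hZ', mlieBracket_add_right hZ hZ', d_symm g Y Z, d_symm g Y Z']
    simp
    ring


theorem exists_sharp (x : M) (φ : TangentSpace 𝓘(ℝ, E) x →ₗ[ℝ] ℝ) :
    ∃ u : TangentSpace 𝓘(ℝ, E) x, ∀ w, g.val x u w = φ w := by
  let L : TangentSpace 𝓘(ℝ, E) x →ₗ[ℝ] Module.Dual ℝ (TangentSpace 𝓘(ℝ, E) x) :=
    ContinuousLinearMap.coeLM ℝ ∘ₗ (g.val x : TangentSpace 𝓘(ℝ, E) x →ₗ[ℝ] _)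
  have hL : Function.Injective L := by
    rw [← LinearMap.ker_eq_bot, LinearMap.ker_eq_bot']
    intro u hu
    exact g.nondegenerate x u fun v ↦ congr($hu v)
  have hs : Function.Surjective L :=
    (LinearMap.injective_iff_surjective_of_finrank_eq_finrank
      Subspace.dual_finrank_eq.symm).1 hL
  obtain ⟨u, hu⟩ := hs φ
  exact ⟨u, fun w ↦ congr($hu w)⟩

theorem ext_of_nondegenerate {x : M} {u v : TangentSpace 𝓘(ℝ, E) x}
    (h : ∀ w, g.val x u w = g.val x v w) : u = v := by
  rw [← sub_eq_zero]
  exact g.nondegenerate x _ fun w ↦ by simp [h w]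

theorem exists_koszul_vector (Y : Π x : M, TangentSpace 𝓘(ℝ, E) x) (x : M) :
    ∃ A : TangentSpace 𝓘(ℝ, E) x →L[ℝ] TangentSpace 𝓘(ℝ, E) x,
      MDiffAt (T% Y) x → ∀ X Z : Π x : M, TangentSpace 𝓘(ℝ, E) x,
        MDiffAt (T% X) x → MDiffAt (T% Z) x →
          2 * g.val x (A (X x)) (Z x) = g.koszul X Y Z x := by
  by_cases hY : MDiffAt (T% Y) x
  swap
  · exact ⟨0, fun h ↦ absurd h hY⟩
  have : T2Space (TangentSpace 𝓘(ℝ, E) x) := inferInstanceAs (T2Space E)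
  let B := TensorialAt.mkHom₂ (I := 𝓘(ℝ, E)) (F := E) (F' := E)
    (fun X Z ↦ g.koszul X Y Z x) x
    (fun Z hZ ↦ g.tensorial₁ hY hZ) (fun X hX ↦ g.tensorial₂ hX hY)
  have hB (X Z : Π x : M, TangentSpace 𝓘(ℝ, E) x) (hX : MDiffAt (T% X) x)
      (hZ : MDiffAt (T% Z) x) : B (X x) (Z x) = g.koszul X Y Z x :=
    TensorialAt.mkHom₂_apply _ _ hX hZ
  choose s hs using g.exists_sharp x
  let A : TangentSpace 𝓘(ℝ, E) x →ₗ[ℝ] TangentSpace 𝓘(ℝ, E) x :=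
    { toFun := fun v ↦ s ((1 / 2 : ℝ) • (B v : TangentSpace 𝓘(ℝ, E) x →ₗ[ℝ] ℝ))
      map_add' := fun u v ↦ g.ext_of_nondegenerate fun w ↦ by
        simp [hs]
        try ring
      map_smul' := fun c v ↦ g.ext_of_nondegenerate fun w ↦ by
        simp [hs]
        try ring }
  refine ⟨LinearMap.toContinuousLinearMap A, fun _ X Z hX hZ ↦ ?_⟩
  rw [← hB X Z hX hZ]
  simp [A, hs]

/-- Existence of the Levi-Civita connection. -/
theorem exists_isLeviCivita :
    ∃ D : CovariantDerivative 𝓘(ℝ, E) E (TangentSpace 𝓘(ℝ, E) : M → Type _),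
      g.IsLeviCivita D := by
  choose D hD using g.exists_koszul_vector
  have key {Y : Π x : M, TangentSpace 𝓘(ℝ, E) x} {x : M} (hY : MDiffAt (T% Y) x)
      (v w : TangentSpace 𝓘(ℝ, E) x) :
      2 * g.val x (D Y x v) w
        = g.koszul (FiberBundle.extend E v) Y (FiberBundle.extend E w) x := by
    rw [← hD Y x hY _ _ (FiberBundle.mdifferentiableAt_extend ..)
      (FiberBundle.mdifferentiableAt_extend ..)]
    simp
  refine ⟨⟨D, ⟨?_, ?_⟩⟩, ⟨?_, ?_⟩⟩
  · intro Y Y' x hY hY' _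
    ext v
    refine g.ext_of_nondegenerate fun w ↦ ?_
    have hv := FiberBundle.mdifferentiableAt_extend 𝓘(ℝ, E) E v
    have hw := FiberBundle.mdifferentiableAt_extend 𝓘(ℝ, E) E w
    have e1 := key (mdifferentiableAt_add_section hY hY') v w
    have e2 := key hY v w
    have e3 := key hY' v w
    simp only [koszul] at e1 e2 e3
    rw [d_symm g _ (Y + Y'), d_add_left hY hY' hv, d_add_left hY hY' hw,
      mlieBracket_add_left hY hY', mlieBracket_add_right hY hY', d_symm g Y, d_symm g Y'] at e1
    have a1 := congr($(d_symm g Y (FiberBundle.extend E w) x) v)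
    have a2 := congr($(d_symm g Y (FiberBundle.extend E v) x) w)
    have a3 := congr($(d_symm g Y' (FiberBundle.extend E w) x) v)
    have a4 := congr($(d_symm g Y' (FiberBundle.extend E v) x) w)
    simp at e1 e2 e3 a1 a2 a3 a4 ⊢
    linarith
  · intro Y f x hY hf _
    ext v
    refine g.ext_of_nondegenerate fun w ↦ ?_
    have hv := FiberBundle.mdifferentiableAt_extend 𝓘(ℝ, E) E v
    have hw := FiberBundle.mdifferentiableAt_extend 𝓘(ℝ, E) E w
    have e1 := key (hf.smul_section hY) v w
    have e2 := key hY v w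
    simp only [koszul] at e1 e2
    rw [d_symm g _ (f • Y), d_smul_left hf hY hv, d_smul_left hf hY hw,
      mlieBracket_smul_left hf hY, mlieBracket_smul_right hf hY, d_symm g Y] at e1
    have a1 := congr($(d_symm g Y (FiberBundle.extend E w) x) v)
    have a2 := congr($(d_symm g Y (FiberBundle.extend E v) x) w)
    simp at e1 e2 a1 a2 ⊢
    linear_combination e1 / 2 - f x / 2 * e2 - f x / 2 * a1 - f x / 2 * a2
  · intro X Y x hX hY
    refine g.ext_of_nondegenerate fun w ↦ ?_
    have hw := FiberBundle.mdifferentiableAt_extend 𝓘(ℝ, E) E w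
    have e1 := hD Y x hY _ _ hX hw
    have e2 := hD X x hX _ _ hY hw
    have a1 := congr($(d_symm g Y (FiberBundle.extend E w) x) (X x))
    have a2 := congr($(d_symm g X (FiberBundle.extend E w) x) (Y x))
    have a3 := congr($(d_symm g X Y x) w)
    simp only [koszul] at e1 e2
    rw [mlieBracket_swap_apply (V := Y) (W := X), mlieBracket_swap_apply (V := X) (W := FiberBundle.extend E w),
      mlieBracket_swap_apply (V := FiberBundle.extend E w) (W := Y)] at e2
    simp at e1 e2 a1 a2 a3 ⊢
    linarith
  · intro Y Z x hY hZ v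
    have hv := FiberBundle.mdifferentiableAt_extend 𝓘(ℝ, E) E v
    have e1 := hD Y x hY _ _ hv hZ
    have e2 := hD Z x hZ _ _ hv hY
    have a1 := congr($(d_symm g Z Y x) v)
    have a2 := congr($(d_symm g Y (FiberBundle.extend E v) x) (Z x))
    have a3 := congr($(d_symm g Z (FiberBundle.extend E v) x) (Y x))
    have a4 := g.symm x (Y x) (D Z x v)
    simp only [koszul] at e1 e2
    rw [mlieBracket_swap_apply (V := Z) (W := Y),
      mlieBracket_swap_apply (V := Y) (W := FiberBundle.extend E v),
      mlieBracket_swap_apply (V := FiberBundle.extend E v) (W := Z)] at e2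
    simp at e1 e2 a1 a2 a3 ⊢
    linarith



/-- The Levi-Civita connection `∇` of `g`; `∇_X Y` at `x` is `g.leviCivita Y x (X x)`. By
`IsLeviCivita.koszul_formula` it is determined by `g` on all differentiable vector fields. -/
def leviCivita : CovariantDerivative 𝓘(ℝ, E) E (TangentSpace 𝓘(ℝ, E) : M → Type _) :=
  Classical.choose g.exists_isLeviCivita

theorem isLeviCivita_leviCivita : g.IsLeviCivita g.leviCivita :=
  Classical.choose_spec g.exists_isLeviCivita

variable {g} in
/-- A Levi-Civita connection satisfies the Koszul formula, hence is unique. -/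
theorem IsLeviCivita.koszul_formula
    {D : CovariantDerivative 𝓘(ℝ, E) E (TangentSpace 𝓘(ℝ, E) : M → Type _)}
    (hD : g.IsLeviCivita D) {X Y Z : Π x : M, TangentSpace 𝓘(ℝ, E) x} {x : M}
    (hX : MDiffAt (T% X) x) (hY : MDiffAt (T% Y) x) (hZ : MDiffAt (T% Z) x) :
    2 * g.val x (D Y x (X x)) (Z x) = g.koszul X Y Z x := by
  simp only [koszul]
  rw [hD.metric hY hZ, hD.metric hZ hX, hD.metric hX hY, ← hD.torsion_free hX hY,
    ← hD.torsion_free hY hZ, ← hD.torsion_free hZ hX]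
  have a1 := g.symm x (Y x) (D Z x (X x))
  have a2 := g.symm x (Z x) (D X x (Y x))
  have a3 := g.symm x (X x) (D Y x (Z x))
  simp
  linarith

end PseudoRiemannianMetric

section HomSections

theorem contMDiffAt_clm_of_apply {F : Type*} [NormedAddCommGroup F] [NormedSpace ℝ F]
    {φ : M → E →L[ℝ] F} {x₀ : M}
    (h : ∀ w : E, ContMDiffAt 𝓘(ℝ, E) 𝓘(ℝ, F) ∞ (fun x ↦ φ x w) x₀) :
    ContMDiffAt 𝓘(ℝ, E) 𝓘(ℝ, E →L[ℝ] F) ∞ φ x₀ := by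
  let d := Module.finrank ℝ E
  have hd : d = Module.finrank ℝ (Fin d → ℝ) := (Module.finrank_fin_fun ℝ).symm
  let e₁ := ContinuousLinearEquiv.ofFinrankEq hd
  let e₂ := (e₁.arrowCongr (1 : F ≃L[ℝ] F)).trans (ContinuousLinearEquiv.piRing (Fin d))
  have : φ = fun x ↦ e₂.symm (e₂ (φ x)) := by ext; simp
  rw [this]
  refine e₂.symm.contDiff.contMDiff.contMDiffAt.comp x₀ (?_ :
    ContMDiffAt 𝓘(ℝ, E) 𝓘(ℝ, Fin d → F) ∞ (fun x ↦ e₂ (φ x)) x₀)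
  rw [contMDiffAt_pi_space]
  intro i
  exact h _

variable {F : Type*} [NormedAddCommGroup F] [NormedSpace ℝ F]
  {V : M → Type*} [TopologicalSpace (TotalSpace F V)] [∀ x, AddCommGroup (V x)]
  [∀ x, Module ℝ (V x)] [∀ x, TopologicalSpace (V x)] [∀ x, IsTopologicalAddGroup (V x)]
  [∀ x, ContinuousSMul ℝ (V x)] [FiberBundle F V] [VectorBundle ℝ F V]

theorem contMDiffAt_hom_of_extend
    {A : Π x : M, TangentSpace 𝓘(ℝ, E) x →L[ℝ] V x} {x₀ : M}
    (h : ∀ v : TangentSpace 𝓘(ℝ, E) x₀, ContMDiffAt 𝓘(ℝ, E) (𝓘(ℝ, E).prod 𝓘(ℝ, F)) ∞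
      (fun x ↦ TotalSpace.mk' F x (A x (FiberBundle.extend E v x))) x₀) :
    ContMDiffAt 𝓘(ℝ, E) (𝓘(ℝ, E).prod 𝓘(ℝ, E →L[ℝ] F)) ∞
      (fun x ↦ TotalSpace.mk' (E →L[ℝ] F)
        (E := fun x : M ↦ TangentSpace 𝓘(ℝ, E) x →L[ℝ] V x) x (A x)) x₀ := by
  rw [contMDiffAt_hom_bundle]
  refine ⟨contMDiffAt_id, contMDiffAt_clm_of_apply fun w ↦ ?_⟩
  have h1 := (contMDiffAt_section _).1 (h ((trivializationAt E (TangentSpace 𝓘(ℝ, E)) x₀).symm x₀ w))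
  refine h1.congr_of_eventuallyEq ?_
  have b1 := (trivializationAt E (TangentSpace 𝓘(ℝ, E)) x₀).open_baseSet.mem_nhds
    (FiberBundle.mem_baseSet_trivializationAt' x₀)
  have b2 := (trivializationAt F V x₀).open_baseSet.mem_nhds
    (FiberBundle.mem_baseSet_trivializationAt' x₀)
  filter_upwards [b1, b2] with x hx1 hx2
  rw [ContinuousLinearMap.inCoordinates_eq hx1 hx2]
  have h2 := (trivializationAt E (TangentSpace 𝓘(ℝ, E)) x₀).apply_mk_symm
    (FiberBundle.mem_baseSet_trivializationAt' x₀) w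
  simp [FiberBundle.extend, h2]


theorem PseudoRiemannianMetric.contMDiffAt_apply (g : PseudoRiemannianMetric E M)
    {E' : Type*} [NormedAddCommGroup E'] [NormedSpace ℝ E']
    {N : Type*} [TopologicalSpace N] [ChartedSpace E' N] {b : N → M}
    {X Y : Π x : N, TangentSpace 𝓘(ℝ, E) (b x)} {x : N}
    (hX : ContMDiffAt 𝓘(ℝ, E') (𝓘(ℝ, E).prod 𝓘(ℝ, E)) ∞
      (fun x ↦ TotalSpace.mk' E (E := (TangentSpace 𝓘(ℝ, E) : M → Type _)) (b x) (X x)) x)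
    (hY : ContMDiffAt 𝓘(ℝ, E') (𝓘(ℝ, E).prod 𝓘(ℝ, E)) ∞
      (fun x ↦ TotalSpace.mk' E (E := (TangentSpace 𝓘(ℝ, E) : M → Type _)) (b x) (Y x)) x) :
    ContMDiffAt 𝓘(ℝ, E') 𝓘(ℝ) ∞ (fun y ↦ g.val (b y) (X y) (Y y)) x := by
  have hb : ContMDiffAt 𝓘(ℝ, E') 𝓘(ℝ, E) ∞ b x := by
    simp only [contMDiffAt_totalSpace] at hX
    exact hX.1
  have : ContMDiffAt 𝓘(ℝ, E') (𝓘(ℝ, E).prod 𝓘(ℝ)) ∞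
      (fun m ↦ TotalSpace.mk' ℝ (E := Bundle.Trivial M ℝ) (b m) (g.val (b m) (X m) (Y m))) x := by
    apply ContMDiffAt.clm_bundle_apply₂ (F₁ := E) (F₂ := E)
    · exact g.contMDiff.contMDiffAt.comp x hb
    · exact hX
    · exact hY
  simp only [contMDiffAt_totalSpace] at this
  exact this.2

theorem contMDiffAt_bilin_of_extend
    {B : Π x : M, TangentSpace 𝓘(ℝ, E) x →L[ℝ] TangentSpace 𝓘(ℝ, E) x →L[ℝ] ℝ} {x₀ : M}
    (h : ∀ v w : TangentSpace 𝓘(ℝ, E) x₀, ContMDiffAt 𝓘(ℝ, E) 𝓘(ℝ) ∞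
      (fun x ↦ B x (FiberBundle.extend E v x) (FiberBundle.extend E w x)) x₀) :
    ContMDiffAt 𝓘(ℝ, E) (𝓘(ℝ, E).prod 𝓘(ℝ, E →L[ℝ] E →L[ℝ] ℝ)) ∞
      (fun x ↦ TotalSpace.mk' (E →L[ℝ] E →L[ℝ] ℝ)
        (E := fun x : M ↦ TangentSpace 𝓘(ℝ, E) x →L[ℝ] TangentSpace 𝓘(ℝ, E) x →L[ℝ] ℝ) x (B x))
      x₀ := by
  refine contMDiffAt_hom_of_extend (V := fun x : M ↦ TangentSpace 𝓘(ℝ, E) x →L[ℝ] ℝ)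
    fun v ↦ ?_
  refine contMDiffAt_hom_of_extend (V := Bundle.Trivial M ℝ)
    (A := fun x ↦ B x (FiberBundle.extend E v x)) fun w ↦ ?_
  rw [contMDiffAt_section]
  exact h v w

/-- A vector field is smooth if its metric dual is. -/
theorem PseudoRiemannianMetric.contMDiffAt_of_flat (g : PseudoRiemannianMetric E M)
    {U : Π x : M, TangentSpace 𝓘(ℝ, E) x} {x₀ : M}
    (h : ContMDiffAt 𝓘(ℝ, E) (𝓘(ℝ, E).prod 𝓘(ℝ, E →L[ℝ] ℝ)) ∞
      (fun x ↦ TotalSpace.mk' (E →L[ℝ] ℝ)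
        (E := fun x : M ↦ TangentSpace 𝓘(ℝ, E) x →L[ℝ] ℝ) x (g.val x (U x))) x₀) :
    ContMDiffAt 𝓘(ℝ, E) (𝓘(ℝ, E).prod 𝓘(ℝ, E)) ∞ (fun x ↦ TotalSpace.mk' E x (U x)) x₀ := by
  rw [contMDiffAt_section] at h ⊢
  have hg := ((contMDiffAt_hom_bundle _).1 (g.contMDiff x₀)).2
  set G := fun x : M ↦ ContinuousLinearMap.inCoordinates E (TangentSpace 𝓘(ℝ, E))
    (E →L[ℝ] ℝ) (fun x : M ↦ TangentSpace 𝓘(ℝ, E) x →L[ℝ] ℝ) x₀ x x₀ x (g.val x) with hG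
  change ContMDiffAt 𝓘(ℝ, E) 𝓘(ℝ, E →L[ℝ] E →L[ℝ] ℝ) ∞ G x₀ at hg
  have b1 := (trivializationAt E (TangentSpace 𝓘(ℝ, E)) x₀).open_baseSet.mem_nhds
    (FiberBundle.mem_baseSet_trivializationAt' x₀)
  have b2 := (trivializationAt (E →L[ℝ] ℝ)
    (fun x : M ↦ TangentSpace 𝓘(ℝ, E) x →L[ℝ] ℝ) x₀).open_baseSet.mem_nhds
    (FiberBundle.mem_baseSet_trivializationAt' x₀)
  have key : ∀ᶠ x in nhds x₀, (∃ e : E ≃L[ℝ] (E →L[ℝ] ℝ), (e : E →L[ℝ] (E →L[ℝ] ℝ)) = G x) ∧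
      G x (trivializationAt E (TangentSpace 𝓘(ℝ, E)) x₀ ⟨x, U x⟩).2 =
        (trivializationAt (E →L[ℝ] ℝ) (fun x : M ↦ TangentSpace 𝓘(ℝ, E) x →L[ℝ] ℝ) x₀
          ⟨x, g.val x (U x)⟩).2 := by
    filter_upwards [b1, b2] with x hx1 hx2
    constructor
    · have inj : Function.Injective (G x : E →ₗ[ℝ] (E →L[ℝ] ℝ)) := by
        rw [← LinearMap.ker_eq_bot, LinearMap.ker_eq_bot']
        intro w hw
        simp only [hG, ContinuousLinearMap.coe_coe] at hw
        rw [ContinuousLinearMap.inCoordinates_eq hx1 hx2] at hw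
        simp only [ContinuousLinearMap.comp_apply, ContinuousLinearEquiv.coe_coe,
          EmbeddingLike.map_eq_zero_iff] at hw
        have h0 := g.nondegenerate x _ fun v ↦ congr($hw v)
        exact (EmbeddingLike.map_eq_zero_iff).1 h0
      have hf : Module.finrank ℝ E = Module.finrank ℝ (E →L[ℝ] ℝ) :=
        Subspace.dual_finrank_eq.symm.trans
          (LinearMap.toContinuousLinearMap (E := E) (F' := ℝ) (𝕜 := ℝ)).finrank_eq
      refine ⟨(LinearEquiv.ofInjectiveOfFinrankEq _ inj hf).toContinuousLinearEquiv, ?_⟩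
      ext v
      rfl
    · simp only [hG]
      rw [ContinuousLinearMap.inCoordinates_eq hx1 hx2]
      simp [Trivialization.symm_apply_apply_mk _ hx1]
  have hinv : ContMDiffAt 𝓘(ℝ, E) 𝓘(ℝ, (E →L[ℝ] ℝ) →L[ℝ] E) ∞
      (fun x ↦ ContinuousLinearMap.inverse (G x)) x₀ := by
    obtain ⟨⟨e, he⟩, -⟩ := key.self_of_nhds
    have := contDiffAt_map_inverse (n := ∞) e
    rw [he] at this
    exact this.contMDiffAt.comp x₀ hg
  refine (hinv.clm_apply h).congr_of_eventuallyEq ?_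
  filter_upwards [key] with x hx
  obtain ⟨⟨e, he⟩, hx⟩ := hx
  rw [← hx, ← he]
  simp

end HomSections

section Structure

variable (E : Type*) [NormedAddCommGroup E] [NormedSpace ℝ E]
  (M : Type*) [TopologicalSpace M] [ChartedSpace E M] [IsManifold 𝓘(ℝ, E) ∞ M]

/-- An almost hypercomplex structure with Hermitian and Norden metrics on `M`: a
pseudo-Riemannian metric `g` and three smooth almost complex structures `J₁, J₂, J₃`, indexed here
by `0, 1, 2 : Fin 3`, with `J_α = J_β J_γ = -J_γ J_β` for all cyclic permutations `(α, β, γ)`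
(that is `β = α + 1` and `γ = α + 2` modulo 3), such that
`g(J₁X, J₁Y) = -g(J₂X, J₂Y) = -g(J₃X, J₃Y) = g(X, Y)`. -/
structure HermitianNordenStructure where
  g : PseudoRiemannianMetric E M
  J (α : Fin 3) (x : M) : TangentSpace 𝓘(ℝ, E) x →L[ℝ] TangentSpace 𝓘(ℝ, E) x
  contMDiff_J (α : Fin 3) : ContMDiff 𝓘(ℝ, E) (𝓘(ℝ, E).prod 𝓘(ℝ, E →L[ℝ] E)) ∞
    (fun x : M ↦ TotalSpace.mk' (E →L[ℝ] E)
      (E := fun x : M ↦ TangentSpace 𝓘(ℝ, E) x →L[ℝ] TangentSpace 𝓘(ℝ, E) x) x (J α x))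
  J_sq (α : Fin 3) (x : M) (v : TangentSpace 𝓘(ℝ, E) x) : J α x (J α x v) = -v
  J_comp (α : Fin 3) (x : M) (v : TangentSpace 𝓘(ℝ, E) x) :
    J α x v = J (α + 1) x (J (α + 2) x v)
  J_comp_swap (α : Fin 3) (x : M) (v : TangentSpace 𝓘(ℝ, E) x) :
    J α x v = -J (α + 2) x (J (α + 1) x v)
  hermitian (x : M) (u v : TangentSpace 𝓘(ℝ, E) x) :
    g.val x (J 0 x u) (J 0 x v) = g.val x u v
  norden (α : Fin 3) (hα : α ≠ 0) (x : M) (u v : TangentSpace 𝓘(ℝ, E) x) :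
    g.val x (J α x u) (J α x v) = -g.val x u v

end Structure

namespace PseudoRiemannianMetric

variable (g : PseudoRiemannianMetric E M)

/-- The contraction `g^{ij} B(e_i, e_j)` over a basis `b = (e_i)` of `T_x M`, where `(g^{ij})` is
the inverse of the matrix `(g(e_i, e_j))`. -/
def contract {ι : Type*} [Fintype ι] [DecidableEq ι] (x : M)
    (b : Module.Basis ι ℝ (TangentSpace 𝓘(ℝ, E) x))
    (B : TangentSpace 𝓘(ℝ, E) x → TangentSpace 𝓘(ℝ, E) x → ℝ) : ℝ :=
  ∑ i, ∑ j, (Matrix.of fun i j ↦ g.val x (b i) (b j))⁻¹ i j * B (b i) (b j)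

/-- The metric at a point as an algebraic bilinear form. -/
def bilin (x : M) : LinearMap.BilinForm ℝ (TangentSpace 𝓘(ℝ, E) x) :=
  ContinuousLinearMap.coeLM ℝ ∘ₗ (g.val x : TangentSpace 𝓘(ℝ, E) x →ₗ[ℝ] _)

theorem contract_eq_trace {ι : Type*} [Fintype ι] [DecidableEq ι] (x : M)
    (b : Module.Basis ι ℝ (TangentSpace 𝓘(ℝ, E) x))
    (B : LinearMap.BilinForm ℝ (TangentSpace 𝓘(ℝ, E) x)) :
    g.contract x b (fun u v ↦ B u v) =
      ((LinearMap.BilinForm.toMatrix b (g.bilin x))⁻¹.transpose *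
        LinearMap.BilinForm.toMatrix b B).trace := by
  simp only [contract, Matrix.trace, Matrix.diag, Matrix.mul_apply, Matrix.transpose_apply,
    LinearMap.BilinForm.toMatrix_apply]
  rw [Finset.sum_comm]
  congr! 4
  ext i j
  simp [LinearMap.BilinForm.toMatrix_apply, bilin]

/-- The contraction of a bilinear form does not depend on the basis. -/
theorem contract_eq {ι κ : Type*} [Fintype ι] [DecidableEq ι] [Fintype κ] [DecidableEq κ] (x : M)
    (b : Module.Basis ι ℝ (TangentSpace 𝓘(ℝ, E) x))
    (c : Module.Basis κ ℝ (TangentSpace 𝓘(ℝ, E) x))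
    (B : LinearMap.BilinForm ℝ (TangentSpace 𝓘(ℝ, E) x)) :
    g.contract x b (fun u v ↦ B u v) = g.contract x c (fun u v ↦ B u v) := by
  have hB : ∀ A : LinearMap.BilinForm ℝ (TangentSpace 𝓘(ℝ, E) x),
      (b.toMatrix c).transpose * LinearMap.BilinForm.toMatrix b A * b.toMatrix c
        = LinearMap.BilinForm.toMatrix c A := fun A ↦
    LinearMap.BilinForm.toMatrix_mul_basis_toMatrix b c A
  have hPQ : b.toMatrix c * c.toMatrix b = 1 := b.toMatrix_mul_toMatrix_flip c
  have hQP : c.toMatrix b * b.toMatrix c = 1 := c.toMatrix_mul_toMatrix_flip b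
  rw [contract_eq_trace, contract_eq_trace, ← hB B, ← hB (g.bilin x)]
  set P := b.toMatrix c
  set Q := c.toMatrix b
  set G := LinearMap.BilinForm.toMatrix b (g.bilin x) with hG
  set A := LinearMap.BilinForm.toMatrix b B
  have hdet : IsUnit G.det := by
    rw [isUnit_iff_ne_zero]
    refine (LinearMap.BilinForm.nondegenerate_iff_det_ne_zero b).1 ⟨fun u hu ↦ ?_, fun u hu ↦ ?_⟩
    · exact g.nondegenerate x u hu
    · exact g.nondegenerate x u fun v ↦ (g.symm x u v).trans (hu v)
  have hGG : G * G⁻¹ = 1 := Matrix.mul_nonsing_inv _ hdet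
  have hinv : (P.transpose * G * P)⁻¹ = Q * G⁻¹ * Q.transpose := by
    apply Matrix.inv_eq_right_inv
    calc P.transpose * G * P * (Q * G⁻¹ * Q.transpose)
        = P.transpose * (G * (P * Q) * G⁻¹) * Q.transpose := by simp only [Matrix.mul_assoc]
      _ = (Q * P).transpose := by
          rw [hPQ, Matrix.mul_one, hGG, Matrix.mul_one, Matrix.transpose_mul]
      _ = 1 := by rw [hQP, Matrix.transpose_one]
  rw [hinv]
  calc (G⁻¹.transpose * A).trace
      = (Q * P * (Q * G⁻¹.transpose * (P * Q).transpose * A * P)).trace := by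
        rw [hQP, hPQ, Matrix.transpose_one, Matrix.one_mul, Matrix.mul_one, Matrix.mul_assoc Q,
          Matrix.mul_assoc, Matrix.trace_mul_comm Q, Matrix.mul_assoc _ P Q, hPQ, Matrix.mul_one]
    _ = _ := by
        rw [hQP, Matrix.one_mul]
        simp only [Matrix.transpose_mul, Matrix.transpose_transpose, Matrix.mul_assoc]

end PseudoRiemannianMetric

namespace HermitianNordenStructure

variable (S : HermitianNordenStructure E M)

variable {S} in
theorem mdifferentiableAt_J (α : Fin 3) {Y : Π x : M, TangentSpace 𝓘(ℝ, E) x} {x : M}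
    (hY : MDiffAt (T% Y) x) : MDiffAt (T% (fun y ↦ S.J α y (Y y))) x :=
  MDifferentiableAt.clm_bundle_apply (F₁ := E) (F₂ := E)
    ((S.contMDiff_J α).contMDiffAt.mdifferentiableAt (by simp)) hY

theorem tensorialAt_covDerivJ
    (D : CovariantDerivative 𝓘(ℝ, E) E (TangentSpace 𝓘(ℝ, E) : M → Type _)) (α : Fin 3) (x : M) :
    TensorialAt 𝓘(ℝ, E) E (fun Y : Π x : M, TangentSpace 𝓘(ℝ, E) x ↦
      D (fun y ↦ S.J α y (Y y)) x - S.J α x ∘L D Y x) x where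
  smul {f Y} hf hY := by
    have h : (fun y ↦ S.J α y ((f • Y) y)) = f • fun y ↦ S.J α y (Y y) := by
      ext y; simp
    rw [h, D.isCovariantDerivativeOn.leibniz (mdifferentiableAt_J α hY) hf,
      D.isCovariantDerivativeOn.leibniz hY hf]
    ext v
    simp [smul_sub]
  add {Y Y'} hY hY' := by
    have h : (fun y ↦ S.J α y ((Y + Y') y)) =
        (fun y ↦ S.J α y (Y y)) + fun y ↦ S.J α y (Y' y) := by
      ext y; simp
    rw [h, D.isCovariantDerivativeOn.add (mdifferentiableAt_J α hY) (mdifferentiableAt_J α hY'),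
      D.isCovariantDerivativeOn.add hY hY']
    ext v
    simp
    abel

/-- The covariant derivative of `J_α`: `S.covDerivJ α x Y X` is `(∇_X J_α) Y` at `x`. -/
def covDerivJ (α : Fin 3) (x : M) : TangentSpace 𝓘(ℝ, E) x →L[ℝ]
    TangentSpace 𝓘(ℝ, E) x →L[ℝ] TangentSpace 𝓘(ℝ, E) x :=
  TensorialAt.mkHom _ x (S.tensorialAt_covDerivJ S.g.leviCivita α x)

theorem covDerivJ_apply (α : Fin 3) {Y : Π x : M, TangentSpace 𝓘(ℝ, E) x} {x : M}
    (hY : MDiffAt (T% Y) x) (v : TangentSpace 𝓘(ℝ, E) x) :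
    S.covDerivJ α x (Y x) v =
      S.g.leviCivita (fun y ↦ S.J α y (Y y)) x v - S.J α x (S.g.leviCivita Y x v) := by
  rw [covDerivJ, TensorialAt.mkHom_apply _ hY]
  rfl

/-- The fundamental tensors `F_α(X, Y, Z) = g((∇_X J_α) Y, Z)`. -/
def F (α : Fin 3) (x : M) (X Y Z : TangentSpace 𝓘(ℝ, E) x) : ℝ :=
  S.g.val x (S.covDerivJ α x Y X) Z

/-- The Lee forms `θ_α(Z) = g^{ij} F_α(e_i, e_j, Z)`; see `leeForm_eq` for an arbitrary basis. -/
def leeForm (α : Fin 3) (x : M) (Z : TangentSpace 𝓘(ℝ, E) x) : ℝ :=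
  S.g.contract x (Module.finBasis ℝ (TangentSpace 𝓘(ℝ, E) x)) fun u v ↦ S.F α x u v Z

theorem leeForm_eq {ι : Type*} [Fintype ι] [DecidableEq ι] (α : Fin 3) (x : M)
    (b : Module.Basis ι ℝ (TangentSpace 𝓘(ℝ, E) x)) (Z : TangentSpace 𝓘(ℝ, E) x) :
    S.leeForm α x Z = S.g.contract x b fun u v ↦ S.F α x u v Z :=
  S.g.contract_eq x _ b (LinearMap.mk₂ ℝ (fun u v ↦ S.F α x u v Z)
    (by intros; simp [F]) (by intros; simp [F]) (by intros; simp [F]) (by intros; simp [F]))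

/-- The Nijenhuis tensor `N_α(X, Y) = [J_α X, J_α Y] - J_α[J_α X, Y] - J_α[X, J_α Y] - [X, Y]` on
vector fields. -/
def nijenhuis (α : Fin 3) (X Y : Π x : M, TangentSpace 𝓘(ℝ, E) x) (x : M) :
    TangentSpace 𝓘(ℝ, E) x :=
  mlieBracket 𝓘(ℝ, E) (fun y ↦ S.J α y (X y)) (fun y ↦ S.J α y (Y y)) x
    - S.J α x (mlieBracket 𝓘(ℝ, E) (fun y ↦ S.J α y (X y)) Y x)
    - S.J α x (mlieBracket 𝓘(ℝ, E) X (fun y ↦ S.J α y (Y y)) x)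
    - mlieBracket 𝓘(ℝ, E) X Y x

/-- `M` is a `4n`-dimensional `𝒲`-manifold: the almost hypercomplex structure is hypercomplex
(all Nijenhuis tensors vanish) and the fundamental tensors are expressed by the Lee forms. -/
structure IsWManifold (n : ℕ) : Prop where
  finrank_eq : Module.finrank ℝ E = 4 * n
  hypercomplex (α : Fin 3) (X Y : Π x : M, TangentSpace 𝓘(ℝ, E) x) (x : M)
    (hX : MDiffAt (T% X) x) (hY : MDiffAt (T% Y) x) : S.nijenhuis α X Y x = 0
  F_one (x : M) (X Y Z : TangentSpace 𝓘(ℝ, E) x) :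
    S.F 0 x X Y Z = 1 / (2 * (2 * (n : ℝ) - 1)) *
      (S.g.val x X Y * S.leeForm 0 x Z - S.g.val x X Z * S.leeForm 0 x Y
        - S.g.val x X (S.J 0 x Y) * S.leeForm 0 x (S.J 0 x Z)
        + S.g.val x X (S.J 0 x Z) * S.leeForm 0 x (S.J 0 x Y))
  F_two_three (α : Fin 3) (hα : α ≠ 0) (x : M) (X Y Z : TangentSpace 𝓘(ℝ, E) x) :
    S.F α x X Y Z = 1 / (4 * (n : ℝ)) *
      (S.g.val x X Y * S.leeForm α x Z + S.g.val x X Z * S.leeForm α x Y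
        + S.g.val x X (S.J α x Y) * S.leeForm α x (S.J α x Z)
        + S.g.val x X (S.J α x Z) * S.leeForm α x (S.J α x Y))

/-- `M` is a `𝒦`-manifold (of hyper-Kähler type): `∇ J_α = 0` for `α = 1, 2, 3`. -/
def IsKManifold : Prop := ∀ (α : Fin 3) (x : M), S.covDerivJ α x = 0

section Submanifold

variable {E' : Type*} [NormedAddCommGroup E'] [NormedSpace ℝ E'] [FiniteDimensional ℝ E']
  {N : Type*} [TopologicalSpace N] [ChartedSpace E' N] [IsManifold 𝓘(ℝ, E') ∞ N]
  (S : HermitianNordenStructure E' N)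

variable (E) in
/-- `f : M → N` exhibits `M` as a holomorphic submanifold of `N`: `f` is a smooth immersion, the
tangent spaces `df(T_x M)` satisfy `J_α(df(T_x M)) = df(T_x M)`, and `g` restricted to
`df(T_x M)` is nondegenerate. -/
structure IsHolomorphicImmersion (f : M → N) : Prop where
  isImmersion : Manifold.IsImmersion 𝓘(ℝ, E) 𝓘(ℝ, E') ∞ f
  invariant (α : Fin 3) (x : M) :
    (mfderiv 𝓘(ℝ, E) 𝓘(ℝ, E') f x).range.map (S.J α (f x)).toLinearMap =
      (mfderiv 𝓘(ℝ, E) 𝓘(ℝ, E') f x).range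
  nondegenerate (x : M) (u : TangentSpace 𝓘(ℝ, E) x)
    (hu : ∀ v, S.g.val (f x) (mfderiv 𝓘(ℝ, E) 𝓘(ℝ, E') f x u)
      (mfderiv 𝓘(ℝ, E) 𝓘(ℝ, E') f x v) = 0) : u = 0

namespace IsHolomorphicImmersion

variable {S} {f : M → N}

theorem injective_mfderiv (hf : S.IsHolomorphicImmersion E f) (x : M) : Function.Injective (mfderiv 𝓘(ℝ, E) 𝓘(ℝ, E') f x) := by
  refine (injective_iff_map_eq_zero _).2 fun u hu ↦ hf.nondegenerate x u fun v ↦ ?_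
  simp [hu]

theorem exists_J (hf : S.IsHolomorphicImmersion E f) (α : Fin 3) (x : M) (v : TangentSpace 𝓘(ℝ, E) x) :
    ∃ u, mfderiv 𝓘(ℝ, E) 𝓘(ℝ, E') f x u =
      S.J α (f x) (mfderiv 𝓘(ℝ, E) 𝓘(ℝ, E') f x v) := by
  have : S.J α (f x) (mfderiv 𝓘(ℝ, E) 𝓘(ℝ, E') f x v) ∈
      (mfderiv 𝓘(ℝ, E) 𝓘(ℝ, E') f x).range := by
    rw [← hf.invariant α x]
    exact ⟨_, ⟨v, rfl⟩, rfl⟩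
  exact this

theorem contMDiffAt_push (hf : S.IsHolomorphicImmersion E f) 
    {X : Π x : M, TangentSpace 𝓘(ℝ, E) x} {x : M}
    (hX : ContMDiffAt 𝓘(ℝ, E) (𝓘(ℝ, E).prod 𝓘(ℝ, E)) ∞ (T% X) x) :
    ContMDiffAt 𝓘(ℝ, E) (𝓘(ℝ, E').prod 𝓘(ℝ, E')) ∞
      (fun y ↦ TotalSpace.mk' E' (E := (TangentSpace 𝓘(ℝ, E') : N → Type _)) (f y)
        (mfderiv 𝓘(ℝ, E) 𝓘(ℝ, E') f y (X y))) x := by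
  have h := hf.isImmersion.contMDiff.contMDiff_tangentMap (m := ∞) le_rfl
  exact h.contMDiffAt.comp x hX

/-- The restriction of the metric `g` to `M`. -/
def inducedMetric (hf : S.IsHolomorphicImmersion E f) : PseudoRiemannianMetric E M where
  val x := ContinuousLinearMap.precomp ℝ (mfderiv 𝓘(ℝ, E) 𝓘(ℝ, E') f x) ∘L
    S.g.val (f x) ∘L mfderiv 𝓘(ℝ, E) 𝓘(ℝ, E') f x
  symm x u v := S.g.symm _ _ _
  nondegenerate x u hu := hf.nondegenerate x u hu
  contMDiff x := contMDiffAt_bilin_of_extend fun v w ↦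
    S.g.contMDiffAt_apply (hf.contMDiffAt_push (FiberBundle.contMDiffAt_extend ..))
      (hf.contMDiffAt_push (FiberBundle.contMDiffAt_extend ..))

theorem exists_inducedJ (hf : S.IsHolomorphicImmersion E f) (α : Fin 3) (x : M) :
    ∃ A : TangentSpace 𝓘(ℝ, E) x →L[ℝ] TangentSpace 𝓘(ℝ, E) x,
      ∀ v, mfderiv 𝓘(ℝ, E) 𝓘(ℝ, E') f x (A v) =
        S.J α (f x) (mfderiv 𝓘(ℝ, E) 𝓘(ℝ, E') f x v) := by
  have : T2Space (TangentSpace 𝓘(ℝ, E) x) := inferInstanceAs (T2Space E)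
  choose s hs using hf.exists_J α x
  let A : TangentSpace 𝓘(ℝ, E) x →ₗ[ℝ] TangentSpace 𝓘(ℝ, E) x :=
    { toFun := s
      map_add' := fun u v ↦ hf.injective_mfderiv x <| by simp [hs]
      map_smul' := fun c v ↦ hf.injective_mfderiv x <| by simp [hs] }
  exact ⟨LinearMap.toContinuousLinearMap A, hs⟩

/-- The restriction of `J_α` to `TM`, determined by `df ∘ J_α = J_α ∘ df`. -/
def inducedJ (hf : S.IsHolomorphicImmersion E f) (α : Fin 3) (x : M) : TangentSpace 𝓘(ℝ, E) x →L[ℝ] TangentSpace 𝓘(ℝ, E) x :=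
  Classical.choose (hf.exists_inducedJ α x)

theorem mfderiv_inducedJ (hf : S.IsHolomorphicImmersion E f) (α : Fin 3) (x : M) (v : TangentSpace 𝓘(ℝ, E) x) :
    mfderiv 𝓘(ℝ, E) 𝓘(ℝ, E') f x (hf.inducedJ α x v) =
      S.J α (f x) (mfderiv 𝓘(ℝ, E) 𝓘(ℝ, E') f x v) :=
  Classical.choose_spec (hf.exists_inducedJ α x) v

/-- A holomorphic submanifold with the restrictions of `g` and `J_α` is again an almost hypercomplex
manifold with Hermitian and Norden metrics. -/
def induced (hf : S.IsHolomorphicImmersion E f) : HermitianNordenStructure E M where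
  g := hf.inducedMetric
  J := hf.inducedJ
  contMDiff_J α x := by
    refine contMDiffAt_hom_of_extend (V := (TangentSpace 𝓘(ℝ, E) : M → Type _)) fun v ↦ ?_
    refine hf.inducedMetric.contMDiffAt_of_flat ?_
    refine contMDiffAt_hom_of_extend (V := Bundle.Trivial M ℝ)
      (A := fun x ↦ hf.inducedMetric.val x (hf.inducedJ α x _)) fun w ↦ ?_
    rw [contMDiffAt_section]
    have h1 := hf.contMDiffAt_push (FiberBundle.contMDiffAt_extend 𝓘(ℝ, E) E (k := ∞) v)
    have h2 := hf.contMDiffAt_push (FiberBundle.contMDiffAt_extend 𝓘(ℝ, E) E (k := ∞) w)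
    have h3 := ((S.contMDiff_J α).contMDiffAt.comp x
      hf.isImmersion.contMDiff.contMDiffAt).clm_bundle_apply h1
    refine (S.g.contMDiffAt_apply h3 h2).congr_of_eventuallyEq (.of_forall fun y ↦ ?_)
    change S.g.val _ (mfderiv 𝓘(ℝ, E) 𝓘(ℝ, E') f y _) _ = _
    rw [hf.mfderiv_inducedJ]
    rfl
  J_sq α x v := hf.injective_mfderiv x <| by simp [hf.mfderiv_inducedJ, S.J_sq]
  J_comp α x v := hf.injective_mfderiv x <| by
    simp only [hf.mfderiv_inducedJ]
    exact S.J_comp ..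
  J_comp_swap α x v := hf.injective_mfderiv x <| by
    simp only [hf.mfderiv_inducedJ, map_neg]
    exact S.J_comp_swap ..
  hermitian x u v := by
    change S.g.val _ (mfderiv 𝓘(ℝ, E) 𝓘(ℝ, E') f x _) (mfderiv 𝓘(ℝ, E) 𝓘(ℝ, E') f x _) = _
    simp only [hf.mfderiv_inducedJ]
    exact S.hermitian ..
  norden α hα x u v := by
    change S.g.val _ (mfderiv 𝓘(ℝ, E) 𝓘(ℝ, E') f x _) (mfderiv 𝓘(ℝ, E) 𝓘(ℝ, E') f x _) = _
    simp only [hf.mfderiv_inducedJ]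
    exact S.norden α hα ..

end IsHolomorphicImmersion

end Submanifold

end HermitianNordenStructure

end

/-! In the charts of an immersion, coordinate fields of `M` are related to commuting coordinate
fields of `N`. For these the Koszul formula involves derivatives of metric coefficients only, so the
tangential part of the ambient connection is the Levi-Civita connection of `M`. As `J_α` preserves
`TM`, the fundamental tensors of `M` are restrictions of those of `N` (`F_induced`). The Nijenhuis
tensors are algebraic in `F_α` and `J_α`, so their vanishing restricts too.

On a `𝒲`-manifold, `F_α` is a fixed expression (`modelTensor`) in `g`, `J_α` and the form `(4n + ε -
1)⁻¹ θ_α`, where `ε = -1` for `J₁` and `ε = 1` otherwise. On `M` the restricted form models `F_α`.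
Contracting a model tensor in dimension `4m` multiplies its form by `4m + ε - 1`
(`leeForm_eq_of_modelTensor`). This gives the ratios of the Lee forms, the `𝒲` conditions, and the
fact that `∇J_α = 0` on `M` for all `α` exactly when all ambient Lee forms vanish on `TM`.

It remains to see that the three restricted Lee forms vanish together, which is where `m < n`
enters. Differentiating `J₁ = J₂J₃` gives a linear relation among the `F_α` (`F_comp`). Evaluated on
a nonzero normal vector `y` and a tangent vector `Z`, it splits into a tangent and a normal part,
each zero by nondegeneracy of `g` on `TM`. Quaternionic independence of `y, J₁y, J₃y` then expresses
the first two forms on `TM` as the third composed with `J₂` and `J₁` (`modelForms_related`). Hence,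
at each point, if one form vanishes on the tangent space, so do all. -/

noncomputable section

open Filter Topology

set_option linter.unusedSectionVars false

variable {E : Type*} [NormedAddCommGroup E] [NormedSpace ℝ E] [FiniteDimensional ℝ E]
  {M : Type*} [TopologicalSpace M] [ChartedSpace E M] [IsManifold 𝓘(ℝ, E) ∞ M]

/-! ### Coordinate vector fields of a chart -/

section CoordinateFields

variable {e : OpenPartialHomeomorph M E}

/-- The coordinate vector field with constant component `u` in the chart `e`. -/
def coordField (e : OpenPartialHomeomorph M E) (u : E) (x : M) : TangentSpace 𝓘(ℝ, E) x :=
  mpullback 𝓘(ℝ, E) 𝓘(ℝ, E) e (fun _ ↦ u) x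

theorem mdifferentiable_of_mem_maximalAtlas
    (he : e ∈ IsManifold.maximalAtlas 𝓘(ℝ, E) ∞ M) : e.MDifferentiable 𝓘(ℝ, E) 𝓘(ℝ, E) :=
  ⟨(contMDiffOn_of_mem_maximalAtlas he).mdifferentiableOn (by simp),
    (contMDiffOn_symm_of_mem_maximalAtlas he).mdifferentiableOn (by simp)⟩

theorem isInvertible_mfderiv_of_mem_maximalAtlas
    (he : e ∈ IsManifold.maximalAtlas 𝓘(ℝ, E) ∞ M) {x : M} (hx : x ∈ e.source) :
    (mfderiv 𝓘(ℝ, E) 𝓘(ℝ, E) e x).IsInvertible :=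
  ⟨(mdifferentiable_of_mem_maximalAtlas he).mfderiv hx, rfl⟩

theorem coordField_mfderiv (he : e ∈ IsManifold.maximalAtlas 𝓘(ℝ, E) ∞ M) {x : M}
    (hx : x ∈ e.source) (v : TangentSpace 𝓘(ℝ, E) x) :
    coordField e (mfderiv 𝓘(ℝ, E) 𝓘(ℝ, E) e x v) x = v :=
  (isInvertible_mfderiv_of_mem_maximalAtlas he hx).inverse_apply_eq.2 rfl

theorem mfderiv_coordField (he : e ∈ IsManifold.maximalAtlas 𝓘(ℝ, E) ∞ M) {x : M}
    (hx : x ∈ e.source) (u : E) :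
    mfderiv 𝓘(ℝ, E) 𝓘(ℝ, E) e x (coordField e u x) = u :=
  ((isInvertible_mfderiv_of_mem_maximalAtlas he hx).inverse_apply_eq.1 rfl).symm

theorem mdifferentiableAt_const_field (u y : E) :
    MDifferentiableAt 𝓘(ℝ, E) (𝓘(ℝ, E).prod 𝓘(ℝ, E))
      (fun z : E ↦ TotalSpace.mk' E (E := (TangentSpace 𝓘(ℝ, E) : E → Type _)) z u) y := by
  have h : ContMDiffAt 𝓘(ℝ, E) (𝓘(ℝ, E).prod 𝓘(ℝ, E)) 1
      (fun z : E ↦ TotalSpace.mk' E (E := (TangentSpace 𝓘(ℝ, E) : E → Type _)) z u) y := by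
    exact contMDiffAt_vectorSpace_iff_contDiffAt.2 contDiffAt_const
  exact h.mdifferentiableAt (by simp)

theorem mdifferentiableAt_coordField (he : e ∈ IsManifold.maximalAtlas 𝓘(ℝ, E) ∞ M) {x : M}
    (hx : x ∈ e.source) (u : E) : MDiffAt (T% (coordField e u)) x := by
  have : CompleteSpace E := FiniteDimensional.complete ℝ E
  exact (mdifferentiableAt_const_field u (e x)).mpullback_vectorField
    (contMDiffAt_of_mem_maximalAtlas he hx) (isInvertible_mfderiv_of_mem_maximalAtlas he hx)
    (ENat.LEInfty.out)

/-- The bracket commutes with pullback by the chart, and constant fields on the model space commute.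
-/
theorem mlieBracket_coordField (he : e ∈ IsManifold.maximalAtlas 𝓘(ℝ, E) ∞ M) {x : M}
    (hx : x ∈ e.source) (u v : E) :
    mlieBracket 𝓘(ℝ, E) (coordField e u) (coordField e v) x = 0 := by
  have : CompleteSpace E := FiniteDimensional.complete ℝ E
  have : IsManifold 𝓘(ℝ, E) (minSmoothness ℝ 3) M := by
    simp only [minSmoothness_of_isRCLikeNormedField]
    exact IsManifold.of_le (n := ∞) (ENat.LEInfty.out)
  have h := mpullback_mlieBracket (mdifferentiableAt_const_field u (e x))
    (mdifferentiableAt_const_field v (e x)) (contMDiffAt_of_mem_maximalAtlas he hx)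
    (by simp only [minSmoothness_of_isRCLikeNormedField]; exact ENat.LEInfty.out)
  refine h.symm.trans ?_
  rw [mpullback_apply]
  have h0 : mlieBracket 𝓘(ℝ, E) (fun _ : E ↦ u) (fun _ ↦ v) (e x) = 0 := by
    have h1 := mlieBracketWithin_eq_lieBracketWithin (𝕜 := ℝ) (V := fun _ : E ↦ u)
      (W := fun _ : E ↦ v) (s := Set.univ)
    simp only [lieBracketWithin_univ] at h1
    exact (congrFun h1 (e x)).trans (by simp [lieBracket]; rfl)
  exact (congrArg _ h0).trans (map_zero _)

end CoordinateFields

/-! ### Related coordinate fields along an immersion -/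

variable {E' : Type*} [NormedAddCommGroup E'] [NormedSpace ℝ E'] [FiniteDimensional ℝ E']
  {N : Type*} [TopologicalSpace N] [ChartedSpace E' N] [IsManifold 𝓘(ℝ, E') ∞ N]

/-- Around every point, an immersion relates coordinate fields of the source to coordinate fields
of the target. -/
theorem Manifold.IsImmersion.exists_related_fields {f : M → N}
    (hf : Manifold.IsImmersion 𝓘(ℝ, E) 𝓘(ℝ, E') ∞ f) (x : M) :
    ∃ (X : TangentSpace 𝓘(ℝ, E) x → Π y : M, TangentSpace 𝓘(ℝ, E) y)
      (X' : TangentSpace 𝓘(ℝ, E) x → Π y : N, TangentSpace 𝓘(ℝ, E') y),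
      (∀ u, X u x = u) ∧ (∀ u, MDiffAt (T% (X u)) x) ∧ (∀ u, MDiffAt (T% (X' u)) (f x)) ∧
      (∀ u v, mlieBracket 𝓘(ℝ, E) (X u) (X v) x = 0) ∧
      (∀ u v, mlieBracket 𝓘(ℝ, E') (X' u) (X' v) (f x) = 0) ∧
      ∀ᶠ y in 𝓝 x, ∀ u, mfderiv 𝓘(ℝ, E) 𝓘(ℝ, E') f y (X u y) = X' u (f y) := by
  have hx := hf.isImmersionAt x
  have he := hx.domChart_mem_maximalAtlas
  have he' := hx.codChart_mem_maximalAtlas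
  have hxs := hx.mem_domChart_source
  have hxs' := hx.mem_codChart_source
  have hw := hx.writtenInCharts
  have hsub := hx.source_subset_preimage_source
  set φ := hx.domChart
  set ψ := hx.codChart
  -- In its adapted charts an immersion is the linear map `L`, so the constant field `w` of the
  -- source corresponds to the constant field `L w` of the target.
  let L : E →L[ℝ] E' := hx.equiv.toContinuousLinearMap ∘L ContinuousLinearMap.inl ℝ E _
  have hL : Set.EqOn (ψ ∘ f) (L ∘ φ) φ.source := by
    intro y hy
    have := hw (x := φ y) (by simpa using φ.map_source hy)
    simpa [φ.left_inv hy, L] using this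
  refine ⟨fun u ↦ coordField φ (mfderiv 𝓘(ℝ, E) 𝓘(ℝ, E) φ x u),
    fun u ↦ coordField ψ (L (mfderiv 𝓘(ℝ, E) 𝓘(ℝ, E) φ x u)),
    fun u ↦ coordField_mfderiv he hxs u, fun u ↦ mdifferentiableAt_coordField he hxs _,
    fun u ↦ mdifferentiableAt_coordField he' hxs' _, fun u v ↦ mlieBracket_coordField he hxs _ _,
    fun u v ↦ mlieBracket_coordField he' hxs' _ _, ?_⟩
  -- A whole neighbourhood is needed: functions built from these fields will be differentiated at
  -- `x`.
  filter_upwards [φ.open_source.mem_nhds hxs] with y hy u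
  let w : E := mfderiv 𝓘(ℝ, E) 𝓘(ℝ, E) φ x u
  have hψ := (mdifferentiable_of_mem_maximalAtlas he').mdifferentiableAt (hsub hy)
  have hφ := (mdifferentiable_of_mem_maximalAtlas he).mdifferentiableAt hy
  have hfy : MDifferentiableAt 𝓘(ℝ, E) 𝓘(ℝ, E') f y :=
    hf.contMDiff.contMDiffAt.mdifferentiableAt (by simp)
  have h1 : mfderiv 𝓘(ℝ, E) 𝓘(ℝ, E') (ψ ∘ f) y = mfderiv 𝓘(ℝ, E) 𝓘(ℝ, E') (L ∘ φ) y :=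
    (hL.eventuallyEq_of_mem (φ.open_source.mem_nhds hy)).mfderiv_eq
  rw [mfderiv_comp y hψ hfy,
    mfderiv_comp y L.differentiableAt.mdifferentiableAt hφ] at h1
  have h2 := congr($h1 (coordField φ w y))
  refine (mdifferentiable_of_mem_maximalAtlas he').mfderiv_injective (hsub hy) (h2.trans ?_)
  refine (congrArg (mfderiv 𝓘(ℝ, E) 𝓘(ℝ, E') L (φ y)) (mfderiv_coordField he hy w)).trans ?_
  refine (congr($(mfderiv_eq_fderiv (f := L)) w).trans congr($(L.fderiv) w)).trans ?_
  exact (mfderiv_coordField he' (hsub hy) (L w)).symm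

theorem mvfderiv_eq_of_eventuallyEq_comp {f : M → N} {x : M}
    (hf : MDifferentiableAt 𝓘(ℝ, E) 𝓘(ℝ, E') f x) {h : M → ℝ} {h' : N → ℝ}
    (hh' : MDiffAt h' (f x)) (hh : h =ᶠ[𝓝 x] h' ∘ f) (v : TangentSpace 𝓘(ℝ, E) x) :
    d% h x v = d% h' (f x) (mfderiv 𝓘(ℝ, E) 𝓘(ℝ, E') f x v) := by
  have h1 : d% h x = d% (h' ∘ f) x := by
    simp only [mvfderiv, hh.mfderiv_eq]
    rfl
  rw [h1]
  exact mvfderiv_comp_apply x hh' hf v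

/-! ### Restriction of the fundamental and Nijenhuis tensors -/

namespace HermitianNordenStructure

/-- The sign `ε` with `g(J_α u, v) = ε g(u, J_α v)`. -/
def adjSign (α : Fin 3) : ℝ := if α = 0 then -1 else 1

theorem val_J_left (S : HermitianNordenStructure E M) (α : Fin 3) (x : M)
    (u v : TangentSpace 𝓘(ℝ, E) x) :
    S.g.val x (S.J α x u) v = adjSign α * S.g.val x u (S.J α x v) := by
  unfold adjSign
  split_ifs with hα
  · subst hα
    have h := S.hermitian x u (S.J 0 x v)
    rw [S.J_sq, map_neg] at h
    linarith
  · have h := S.norden α hα x u (S.J α x v)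
    rw [S.J_sq, map_neg] at h
    linarith

/-- Metric compatibility moves the derivative off `J_α Y`. Only covariant derivatives of `Y` and `Z`
themselves remain, so for coordinate fields no bracket involving `J_α Y` has to be computed. -/
theorem F_eq (S : HermitianNordenStructure E M) (α : Fin 3) {x : M}
    {Y Z : Π x : M, TangentSpace 𝓘(ℝ, E) x} (hY : MDiffAt (T% Y) x) (hZ : MDiffAt (T% Z) x)
    (v : TangentSpace 𝓘(ℝ, E) x) :
    S.F α x v (Y x) (Z x) =
      d% (fun y ↦ S.g.val y (S.J α y (Y y)) (Z y)) x v
        - S.g.val x (S.J α x (Y x)) (S.g.leviCivita Z x v)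
        - adjSign α * S.g.val x (S.g.leviCivita Y x v) (S.J α x (Z x)) := by
  rw [F, S.covDerivJ_apply α hY,
    S.g.isLeviCivita_leviCivita.metric (mdifferentiableAt_J α hY) hZ, ← S.val_J_left]
  simp

namespace IsHolomorphicImmersion

variable {S : HermitianNordenStructure E' N} {f : M → N}

theorem val_induced (hf : S.IsHolomorphicImmersion E f) (x : M) (u v : TangentSpace 𝓘(ℝ, E) x) :
    hf.induced.g.val x u v = S.g.val (f x) (mfderiv 𝓘(ℝ, E) 𝓘(ℝ, E') f x u)
      (mfderiv 𝓘(ℝ, E) 𝓘(ℝ, E') f x v) := rfl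

theorem mfderiv_J (hf : S.IsHolomorphicImmersion E f) (α : Fin 3) (x : M)
    (v : TangentSpace 𝓘(ℝ, E) x) :
    mfderiv 𝓘(ℝ, E) 𝓘(ℝ, E') f x (hf.induced.J α x v) =
      S.J α (f x) (mfderiv 𝓘(ℝ, E) 𝓘(ℝ, E') f x v) :=
  hf.mfderiv_inducedJ α x v

theorem mdifferentiableAt (hf : S.IsHolomorphicImmersion E f) (x : M) :
    MDifferentiableAt 𝓘(ℝ, E) 𝓘(ℝ, E') f x :=
  hf.isImmersion.contMDiff.contMDiffAt.mdifferentiableAt (by simp)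

/-- The Gauss formula: the fundamental tensors of a holomorphic submanifold are the restrictions
of the ambient ones. -/
theorem F_induced (hf : S.IsHolomorphicImmersion E f) (α : Fin 3) (x : M)
    (u v w : TangentSpace 𝓘(ℝ, E) x) :
    hf.induced.F α x u v w = S.F α (f x) (mfderiv 𝓘(ℝ, E) 𝓘(ℝ, E') f x u)
      (mfderiv 𝓘(ℝ, E) 𝓘(ℝ, E') f x v) (mfderiv 𝓘(ℝ, E) 𝓘(ℝ, E') f x w) := by
  obtain ⟨X, X', hXx, hX, hX', hb, hb', hrel⟩ := hf.isImmersion.exists_related_fields x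
  have hrelx (u : TangentSpace 𝓘(ℝ, E) x) :
      X' u (f x) = mfderiv 𝓘(ℝ, E) 𝓘(ℝ, E') f x u := by
    rw [← hrel.self_of_nhds u, hXx]
  have hd (u v w : TangentSpace 𝓘(ℝ, E) x) :
      d% (fun y ↦ hf.induced.g.val y (X v y) (X w y)) x u =
        d% (fun y ↦ S.g.val y (X' v y) (X' w y)) (f x) (mfderiv 𝓘(ℝ, E) 𝓘(ℝ, E') f x u) := by
    refine mvfderiv_eq_of_eventuallyEq_comp (hf.mdifferentiableAt x)
      (PseudoRiemannianMetric.mdifferentiableAt_apply (hX' v) (hX' w)) ?_ u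
    filter_upwards [hrel] with y hy
    simp [val_induced, hy]
  have hdJ (u v w : TangentSpace 𝓘(ℝ, E) x) :
      d% (fun y ↦ hf.induced.g.val y (hf.induced.J α y (X v y)) (X w y)) x u =
        d% (fun y ↦ S.g.val y (S.J α y (X' v y)) (X' w y)) (f x)
          (mfderiv 𝓘(ℝ, E) 𝓘(ℝ, E') f x u) := by
    refine mvfderiv_eq_of_eventuallyEq_comp (hf.mdifferentiableAt x)
      (PseudoRiemannianMetric.mdifferentiableAt_apply (mdifferentiableAt_J α (hX' v)) (hX' w)) ?_ u
    filter_upwards [hrel] with y hy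
    simp [val_induced, mfderiv_J, hy]
  -- The tangential part of the Gauss formula: all brackets vanish in both Koszul formulas, and the
  -- remaining derivatives agree by `hd`.
  have hnabla (u v w : TangentSpace 𝓘(ℝ, E) x) :
      hf.induced.g.val x (hf.induced.g.leviCivita (X v) x u) w =
        S.g.val (f x) (S.g.leviCivita (X' v) (f x) (mfderiv 𝓘(ℝ, E) 𝓘(ℝ, E') f x u))
          (mfderiv 𝓘(ℝ, E) 𝓘(ℝ, E') f x w) := by
    have h1 := hf.induced.g.isLeviCivita_leviCivita.koszul_formula (hX u) (hX v) (hX w)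
    have h2 := S.g.isLeviCivita_leviCivita.koszul_formula (hX' u) (hX' v) (hX' w)
    simp only [PseudoRiemannianMetric.koszul, hb, hb', hXx, hrelx, hd] at h1 h2
    simp only [map_zero, _root_.zero_apply] at h1 h2
    linarith
  have e1 := hf.induced.F_eq α (hX v) (hX w) u
  have e2 := S.F_eq α (hX' v) (hX' w) (mfderiv 𝓘(ℝ, E) 𝓘(ℝ, E') f x u)
  simp only [hXx, hrelx] at e1 e2
  rw [e1, e2, hdJ, hf.induced.g.symm x (hf.induced.J α x v), hnabla, hnabla, mfderiv_J, mfderiv_J,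
    S.g.symm (f x) (S.J α (f x) _)]

end IsHolomorphicImmersion

/-- The Nijenhuis tensor in terms of the covariant derivative of `J_α`. -/
theorem nijenhuis_eq (S : HermitianNordenStructure E M) (α : Fin 3) {x : M}
    {X Y : Π x : M, TangentSpace 𝓘(ℝ, E) x} (hX : MDiffAt (T% X) x) (hY : MDiffAt (T% Y) x) :
    S.nijenhuis α X Y x =
      S.covDerivJ α x (Y x) (S.J α x (X x)) - S.covDerivJ α x (X x) (S.J α x (Y x))
        + S.J α x (S.covDerivJ α x (X x) (Y x)) - S.J α x (S.covDerivJ α x (Y x) (X x)) := by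
  have hJX := mdifferentiableAt_J (S := S) α hX
  have hJY := mdifferentiableAt_J (S := S) α hY
  have hD := S.g.isLeviCivita_leviCivita
  -- Torsion-freeness turns every bracket into a difference of covariant derivatives; the terms
  -- without a derivative of `J_α` cancel by `J_α² = -1`.
  simp only [nijenhuis, ← hD.torsion_free hX hY, ← hD.torsion_free hJX hJY,
    ← hD.torsion_free hX hJY, ← hD.torsion_free hJX hY, S.covDerivJ_apply α hX,
    S.covDerivJ_apply α hY, map_sub, S.J_sq]
  abel

/-- The Nijenhuis tensor as a trilinear form, in terms of the fundamental tensor. -/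
theorem val_nijenhuis (S : HermitianNordenStructure E M) (α : Fin 3) {x : M}
    {X Y : Π x : M, TangentSpace 𝓘(ℝ, E) x} (hX : MDiffAt (T% X) x) (hY : MDiffAt (T% Y) x)
    (w : TangentSpace 𝓘(ℝ, E) x) :
    S.g.val x (S.nijenhuis α X Y x) w =
      S.F α x (S.J α x (X x)) (Y x) w - S.F α x (S.J α x (Y x)) (X x) w
        + adjSign α * (S.F α x (Y x) (X x) (S.J α x w) - S.F α x (X x) (Y x) (S.J α x w)) := by
  rw [S.nijenhuis_eq α hX hY]
  simp only [map_sub, map_add, _root_.sub_apply, _root_.add_apply,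
    S.val_J_left, F]
  ring

/-- By `val_nijenhuis` the tensor depends only on `F_α` and `J_α` at the point, and both restrict.
Hence any extensions to `N` of the two pushed-forward vectors serve; they need not be related to `X`
and `Y`. -/
theorem IsHolomorphicImmersion.nijenhuis_induced {S : HermitianNordenStructure E' N} {f : M → N}
    (hf : S.IsHolomorphicImmersion E f) (α : Fin 3)
    (hS : ∀ (X Y : Π x : N, TangentSpace 𝓘(ℝ, E') x) (x : N), MDiffAt (T% X) x →
      MDiffAt (T% Y) x → S.nijenhuis α X Y x = 0)
    {x : M} {X Y : Π x : M, TangentSpace 𝓘(ℝ, E) x}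
    (hX : MDiffAt (T% X) x) (hY : MDiffAt (T% Y) x) : hf.induced.nijenhuis α X Y x = 0 := by
  refine hf.induced.g.nondegenerate x _ fun w ↦ ?_
  have h1 := FiberBundle.mdifferentiableAt_extend 𝓘(ℝ, E') E'
    (mfderiv 𝓘(ℝ, E) 𝓘(ℝ, E') f x (X x))
  have h2 := FiberBundle.mdifferentiableAt_extend 𝓘(ℝ, E') E'
    (mfderiv 𝓘(ℝ, E) 𝓘(ℝ, E') f x (Y x))
  have h := S.val_nijenhuis α h1 h2 (mfderiv 𝓘(ℝ, E) 𝓘(ℝ, E') f x w)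
  rw [hS _ _ _ h1 h2] at h
  simp only [FiberBundle.extend_apply_self, map_zero, _root_.zero_apply] at h
  rw [hf.induced.val_nijenhuis α hX hY]
  simp only [hf.F_induced, hf.mfderiv_J]
  exact h.symm

end HermitianNordenStructure

/-! ### Contractions and Lee forms of model tensors -/

theorem PseudoRiemannianMetric.isUnit_det_toMatrix_bilin (g : PseudoRiemannianMetric E M)
    {ι : Type*} [Fintype ι] [DecidableEq ι] (x : M)
    (b : Module.Basis ι ℝ (TangentSpace 𝓘(ℝ, E) x)) :
    IsUnit (LinearMap.BilinForm.toMatrix b (g.bilin x)).det := by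
  rw [isUnit_iff_ne_zero]
  refine (LinearMap.BilinForm.nondegenerate_iff_det_ne_zero b).1 ⟨fun u hu ↦ ?_, fun u hu ↦ ?_⟩
  · exact g.nondegenerate x u hu
  · exact g.nondegenerate x u fun v ↦ (g.symm x u v).trans (hu v)

/-- If `G` is the symmetric Gram matrix of `g`, the form `g(u, A v)` has matrix `G [A]`, and
contraction cancels `G`. -/
theorem PseudoRiemannianMetric.contract_val_right (g : PseudoRiemannianMetric E M)
    {ι : Type*} [Fintype ι] [DecidableEq ι] (x : M)
    (b : Module.Basis ι ℝ (TangentSpace 𝓘(ℝ, E) x))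
    (A : TangentSpace 𝓘(ℝ, E) x →ₗ[ℝ] TangentSpace 𝓘(ℝ, E) x) :
    g.contract x b (fun u v ↦ g.val x u (A v)) = LinearMap.trace ℝ _ A := by
  have h := g.contract_eq_trace x b ((g.bilin x).compRight A)
  have hsymm : (LinearMap.BilinForm.toMatrix b (g.bilin x)).transpose =
      LinearMap.BilinForm.toMatrix b (g.bilin x) := by
    ext i j
    simp only [Matrix.transpose_apply, LinearMap.BilinForm.toMatrix_apply]
    exact g.symm x _ _
  rw [LinearMap.BilinForm.toMatrix_compRight, Matrix.transpose_nonsing_inv, hsymm,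
    Matrix.nonsing_inv_mul_cancel_left _ _ (g.isUnit_det_toMatrix_bilin x b),
    ← LinearMap.trace_eq_matrix_trace] at h
  exact h

namespace HermitianNordenStructure

variable (S : HermitianNordenStructure E M)

/-- `J_α = J_β J_γ = -J_γ J_β`, and the trace does not see the order of the factors. -/
theorem trace_J (α : Fin 3) (x : M) :
    LinearMap.trace ℝ _ (S.J α x : TangentSpace 𝓘(ℝ, E) x →ₗ[ℝ] TangentSpace 𝓘(ℝ, E) x) = 0 := by
  have h1 : (S.J α x : TangentSpace 𝓘(ℝ, E) x →ₗ[ℝ] TangentSpace 𝓘(ℝ, E) x) =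
      (S.J (α + 1) x).toLinearMap * (S.J (α + 2) x).toLinearMap :=
    LinearMap.ext fun v ↦ S.J_comp α x v
  have h2 : (S.J α x : TangentSpace 𝓘(ℝ, E) x →ₗ[ℝ] TangentSpace 𝓘(ℝ, E) x) =
      -((S.J (α + 2) x).toLinearMap * (S.J (α + 1) x).toLinearMap) :=
    LinearMap.ext fun v ↦ S.J_comp_swap α x v
  have h3 := congrArg (LinearMap.trace ℝ _) h1
  have h4 := congrArg (LinearMap.trace ℝ _) h2
  rw [map_neg, LinearMap.trace_mul_comm] at h4
  linarith

/-- The Lee form `θ_α` at `x` as a linear form. -/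
def leeLinear (α : Fin 3) (x : M) : TangentSpace 𝓘(ℝ, E) x →ₗ[ℝ] ℝ where
  toFun := S.leeForm α x
  map_add' u v := by
    simp [leeForm, PseudoRiemannianMetric.contract, F, mul_add, Finset.sum_add_distrib]
  map_smul' c v := by
    simp only [leeForm, PseudoRiemannianMetric.contract, F, map_smul, smul_eq_mul, RingHom.id_apply,
      Finset.mul_sum]
    exact Finset.sum_congr rfl fun i _ ↦ Finset.sum_congr rfl fun j _ ↦ by ring

@[simp]
theorem leeLinear_apply (α : Fin 3) (x : M) (Z : TangentSpace 𝓘(ℝ, E) x) :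
    S.leeLinear α x Z = S.leeForm α x Z := rfl

/-- The tensor built from `g`, `J_α` and a linear form `φ` which models the fundamental tensor
`F_α` on `𝒲`-manifolds. -/
def modelTensor (α : Fin 3) (x : M) (φ : TangentSpace 𝓘(ℝ, E) x →ₗ[ℝ] ℝ)
    (X Y Z : TangentSpace 𝓘(ℝ, E) x) : ℝ :=
  S.g.val x X Y * φ Z + adjSign α * S.g.val x X Z * φ Y
    + adjSign α * S.g.val x X (S.J α x Y) * φ (S.J α x Z)
    + S.g.val x X (S.J α x Z) * φ (S.J α x Y)

variable {S} in
-- For fixed `Z` the model tensor is `g(X, A Y)`, so the Lee form is `tr A`. The four terms of `A`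
-- contribute `dim · φ Z`, `ε φ Z`, a multiple of `tr J_α = 0`, and `φ (J_α² Z) = -φ Z`.
theorem leeForm_eq_of_modelTensor {α : Fin 3} {x : M} {φ : TangentSpace 𝓘(ℝ, E) x →ₗ[ℝ] ℝ}
    (h : ∀ X Y Z, S.F α x X Y Z = S.modelTensor α x φ X Y Z) (Z : TangentSpace 𝓘(ℝ, E) x) :
    S.leeForm α x Z = (Module.finrank ℝ E + adjSign α - 1) * φ Z := by
  let A : TangentSpace 𝓘(ℝ, E) x →ₗ[ℝ] TangentSpace 𝓘(ℝ, E) x :=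
    φ Z • LinearMap.id + adjSign α • φ.smulRight Z
      + (adjSign α * φ (S.J α x Z)) • (S.J α x).toLinearMap
      + (φ ∘ₗ (S.J α x).toLinearMap).smulRight (S.J α x Z)
  have hA : (fun X Y ↦ S.F α x X Y Z) = fun X Y ↦ S.g.val x X (A Y) := by
    ext X Y
    simp [h, modelTensor, A]
    ring
  have hfr : Module.finrank ℝ (TangentSpace 𝓘(ℝ, E) x) = Module.finrank ℝ E := rfl
  rw [leeForm, hA, PseudoRiemannianMetric.contract_val_right]
  simp only [A, map_add, map_smul, LinearMap.trace_id, LinearMap.trace_smulRight, S.trace_J,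
    LinearMap.comp_apply, ContinuousLinearMap.coe_coe, S.J_sq, map_neg, smul_eq_mul, hfr]
  ring

variable {S} in
-- Both defining formulas have one shape up to the sign `ε`: the factor `4n + ε - 1` is `2(2n - 1)`
-- for `ε = -1` and `4n` for `ε = 1`.
theorem IsWManifold.F_eq_modelTensor {n : ℕ} (hS : S.IsWManifold n) (α : Fin 3) (x : M)
    (X Y Z : TangentSpace 𝓘(ℝ, E) x) :
    S.F α x X Y Z =
      S.modelTensor α x ((4 * (n : ℝ) + adjSign α - 1)⁻¹ • S.leeLinear α x) X Y Z := by
  by_cases hα : α = 0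
  · subst hα
    rw [hS.F_one]
    have : (4 * (n : ℝ) + -1 - 1) = 2 * (2 * n - 1) := by ring
    simp only [modelTensor, adjSign, if_true, LinearMap.smul_apply, leeLinear_apply, smul_eq_mul,
      this]
    ring
  · rw [hS.F_two_three α hα]
    have : (4 * (n : ℝ) + 1 - 1) = 4 * n := by ring
    simp only [modelTensor, adjSign, hα, if_false, LinearMap.smul_apply, leeLinear_apply,
      smul_eq_mul, this]
    ring

theorem four_mul_add_adjSign_ne_zero (α : Fin 3) {n : ℕ} (hn : n ≠ 0) :
    4 * (n : ℝ) + adjSign α - 1 ≠ 0 := by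
  have : (1 : ℝ) ≤ n := by exact_mod_cast Nat.one_le_iff_ne_zero.2 hn
  unfold adjSign
  split_ifs <;> linarith

/-! ### Quaternionic coupling of the three forms -/

/-- The relation between the fundamental tensors which follows from `J_α = J_β J_γ`. -/
theorem F_comp (α : Fin 3) (x : M) (X Y Z : TangentSpace 𝓘(ℝ, E) x) :
    S.F α x X Y Z = S.F (α + 1) x X (S.J (α + 2) x Y) Z
      + adjSign (α + 1) * S.F (α + 2) x X Y (S.J (α + 1) x Z) := by
  have hV := FiberBundle.mdifferentiableAt_extend 𝓘(ℝ, E) E Y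
  have h0 := S.covDerivJ_apply α hV X
  -- Leibniz rule for `J_β J_γ`: evaluating `∇J_β` on the field `J_γ V` produces `∇(J_α V)`, and the
  -- terms `J_β ∇(J_γ V)` cancel against those from `h2`.
  have h1 := S.covDerivJ_apply (α + 1) (mdifferentiableAt_J (S := S) (α + 2) hV) X
  have h2 := S.covDerivJ_apply (α + 2) hV X
  simp only [FiberBundle.extend_apply_self, ← S.J_comp α] at h0 h1 h2
  simp only [F, ← S.val_J_left]
  rw [h0, h1, h2, S.J_comp α x (S.g.leviCivita _ x X)]
  simp

/-- Applying the conjugate `a - b J₁ - c J₃` to the relation leaves `(a² + b² + c²) y = 0`. -/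
theorem eq_zero_of_quaternionic_relation {x : M} {y : TangentSpace 𝓘(ℝ, E) x} (hy : y ≠ 0)
    {a b c : ℝ} (h : a • y + b • S.J 0 x y + c • S.J 2 x y = 0) : a = 0 ∧ b = 0 ∧ c = 0 := by
  have h1 : S.J 1 x y = S.J 2 x (S.J 0 x y) := S.J_comp 1 x y
  have h2 : S.J 1 x y = -S.J 0 x (S.J 2 x y) := S.J_comp_swap 1 x y
  have h3 : S.J 0 x (S.J 2 x y) = -S.J 1 x y := by rw [h2, neg_neg]
  have e0 := congrArg (S.J 0 x) h
  have e2 := congrArg (S.J 2 x) h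
  simp only [map_add, map_smul, S.J_sq, map_zero, h3, ← h1] at e0 e2
  have key : (a ^ 2 + b ^ 2 + c ^ 2) • y = 0 := by
    linear_combination (norm := module) a • h - b • e0 - c • e2
  have hsum := (smul_eq_zero.1 key).resolve_right hy
  refine ⟨?_, ?_, ?_⟩ <;> nlinarith [sq_nonneg a, sq_nonneg b, sq_nonneg c]

/-- On a proper invariant nondegenerate subspace, linear forms modelling the three fundamental
tensors determine each other. -/
theorem modelForms_related {x : M} {ψ : Fin 3 → TangentSpace 𝓘(ℝ, E) x →ₗ[ℝ] ℝ}
    (hψ : ∀ α X Y Z, S.F α x X Y Z = S.modelTensor α x (ψ α) X Y Z)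
    {V : Submodule ℝ (TangentSpace 𝓘(ℝ, E) x)} (hJ : ∀ α, ∀ v ∈ V, S.J α x v ∈ V)
    (hV : ∀ v ∈ V, (∀ w ∈ V, S.g.val x v w = 0) → v = 0)
    {y : TangentSpace 𝓘(ℝ, E) x} (hy : y ≠ 0) (hyV : ∀ v ∈ V, S.g.val x y v = 0)
    {Z : TangentSpace 𝓘(ℝ, E) x} (hZ : Z ∈ V) :
    ψ 0 Z = ψ 2 (S.J 1 x Z) ∧ ψ 1 Z = ψ 2 (S.J 0 x Z) := by
  have j0 : S.J 1 x (S.J 2 x y) = S.J 0 x y := (S.J_comp 0 x y).symm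
  have j0' : S.J 2 x (S.J 1 x Z) = -S.J 0 x Z := by
    rw [show S.J 0 x Z = -S.J 2 x (S.J 1 x Z) from S.J_comp_swap 0 x Z, neg_neg]
  -- `W` and `P` collect the vectors paired with `X` when `F_comp 0` is written out at `(X, y, Z)`
  -- with the model tensors: `W` is normal to `V`, `P` lies in `V`.
  set W := (ψ 0 Z - ψ 2 (S.J 1 x Z)) • y + (-ψ 0 (S.J 0 x Z) - ψ 1 (S.J 1 x Z)) • S.J 0 x y
    + (ψ 2 (S.J 0 x Z) - ψ 1 Z) • S.J 2 x y with hW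
  set P := (-ψ 0 y - ψ 1 (S.J 2 x y)) • Z + (ψ 0 (S.J 0 x y) + ψ 2 (S.J 2 x y)) • S.J 0 x Z
    + (-ψ 1 (S.J 0 x y) - ψ 2 y) • S.J 1 x Z with hP
  have hsum : W + P = 0 := by
    refine S.g.nondegenerate x _ fun X ↦ ?_
    rw [S.g.symm]
    have h : S.F 0 x X y Z = S.F 1 x X (S.J 2 x y) Z + adjSign 1 * S.F 2 x X y (S.J 1 x Z) :=
      S.F_comp 0 x X y Z
    simp [hψ, modelTensor, j0, j0', adjSign] at h
    simp [hW, hP]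
    linear_combination h
  have hPV : P ∈ V := V.add_mem (V.add_mem (V.smul_mem _ hZ) (V.smul_mem _ (hJ 0 Z hZ)))
    (V.smul_mem _ (hJ 1 Z hZ))
  have hP0 : P = 0 := by
    -- `P = -W` lies in `V` and is orthogonal to `V`, since the invariance of `V` makes `J₁y` and
    -- `J₃y` normal along with `y`.
    refine hV P hPV fun w hw ↦ ?_
    rw [eq_neg_of_add_eq_zero_right hsum]
    simp [hW, S.val_J_left, hyV w hw, hyV _ (hJ 0 w hw), hyV _ (hJ 2 w hw)]
  rw [hP0, add_zero] at hsum
  obtain ⟨h1, -, h2⟩ := S.eq_zero_of_quaternionic_relation hy hsum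
  exact ⟨sub_eq_zero.1 h1, (sub_eq_zero.1 h2).symm⟩

/-- `modelForms_related` writes `ψ 0` and `ψ 1` on `V` as `ψ 2` composed with bijections of `V`, so
vanishing passes to `ψ 2` and from it to the others. -/
theorem modelForms_vanish {x : M} {ψ : Fin 3 → TangentSpace 𝓘(ℝ, E) x →ₗ[ℝ] ℝ}
    (hψ : ∀ α X Y Z, S.F α x X Y Z = S.modelTensor α x (ψ α) X Y Z)
    {V : Submodule ℝ (TangentSpace 𝓘(ℝ, E) x)} (hJ : ∀ α, ∀ v ∈ V, S.J α x v ∈ V)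
    (hV : ∀ v ∈ V, (∀ w ∈ V, S.g.val x v w = 0) → v = 0)
    {y : TangentSpace 𝓘(ℝ, E) x} (hy : y ≠ 0) (hyV : ∀ v ∈ V, S.g.val x y v = 0)
    {α : Fin 3} (hα : ∀ Z ∈ V, ψ α Z = 0) (β : Fin 3) : ∀ Z ∈ V, ψ β Z = 0 := by
  have hrel {Z : TangentSpace 𝓘(ℝ, E) x} (hZ : Z ∈ V) := S.modelForms_related hψ hJ hV hy hyV hZ
  have h2 : ∀ Z ∈ V, ψ 2 Z = 0 := by
    intro Z hZ
    fin_cases α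
    -- The relation is inverted by taking it at `J Z`, as `J² = -1`.
    · have := (hrel (hJ 1 Z hZ)).1
      rw [S.J_sq, map_neg] at this
      exact neg_eq_zero.1 (this.symm.trans (hα _ (hJ 1 Z hZ)))
    · have := (hrel (hJ 0 Z hZ)).2
      rw [S.J_sq, map_neg] at this
      exact neg_eq_zero.1 (this.symm.trans (hα _ (hJ 0 Z hZ)))
    · exact hα Z hZ
  intro Z hZ
  fin_cases β
  · exact (hrel hZ).1.trans (h2 _ (hJ 1 Z hZ))
  · exact (hrel hZ).2.trans (h2 _ (hJ 0 Z hZ))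
  · exact h2 Z hZ

end HermitianNordenStructure

/-! ### Holomorphic submanifolds of `𝒲`-manifolds -/

namespace HermitianNordenStructure.IsHolomorphicImmersion

variable {S : HermitianNordenStructure E' N} {f : M → N}

theorem finrank_eq_of_tangent (x : M) :
    Module.finrank ℝ (TangentSpace 𝓘(ℝ, E) x) = Module.finrank ℝ E := rfl

/-- The map sending `y` to `g(y, df ·)` goes into the dual of the smaller tangent space, so it has a
kernel. -/
theorem exists_normal (hdim : Module.finrank ℝ E < Module.finrank ℝ E') (x : M) :
    ∃ y : TangentSpace 𝓘(ℝ, E') (f x), y ≠ 0 ∧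
      ∀ v ∈ (mfderiv 𝓘(ℝ, E) 𝓘(ℝ, E') f x).range, S.g.val (f x) y v = 0 := by
  let L : TangentSpace 𝓘(ℝ, E') (f x) →ₗ[ℝ] Module.Dual ℝ (TangentSpace 𝓘(ℝ, E) x) :=
    (mfderiv 𝓘(ℝ, E) 𝓘(ℝ, E') f x).toLinearMap.dualMap ∘ₗ S.g.bilin (f x)
  have hL : LinearMap.ker L ≠ ⊥ := by
    refine LinearMap.ker_ne_bot_of_finrank_lt ?_
    rw [Subspace.dual_finrank_eq]
    exact hdim
  obtain ⟨y, hy, hy0⟩ := (Submodule.ne_bot_iff _).1 hL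
  refine ⟨y, hy0, ?_⟩
  rintro _ ⟨v, rfl⟩
  exact congr($(LinearMap.mem_ker.1 hy) v)

/-- At each point, if one Lee form of the ambient `𝒲`-manifold vanishes on the tangent space of a
proper holomorphic submanifold, then all of them do. -/
theorem leeForm_vanish (hf : S.IsHolomorphicImmersion E f) {n : ℕ} (hS : S.IsWManifold n)
    (hdim : Module.finrank ℝ E < Module.finrank ℝ E') {x : M} {α : Fin 3}
    (hα : ∀ Z, S.leeForm α (f x) (mfderiv 𝓘(ℝ, E) 𝓘(ℝ, E') f x Z) = 0) (β : Fin 3)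
    (Z : TangentSpace 𝓘(ℝ, E) x) :
    S.leeForm β (f x) (mfderiv 𝓘(ℝ, E) 𝓘(ℝ, E') f x Z) = 0 := by
  have hn : n ≠ 0 := by
    have := hS.finrank_eq
    omega
  obtain ⟨y, hy, hyV⟩ := exists_normal (S := S) (f := f) hdim x
  have h := S.modelForms_vanish (fun α X Y Z ↦ hS.F_eq_modelTensor α (f x) X Y Z)
    (V := (mfderiv 𝓘(ℝ, E) 𝓘(ℝ, E') f x).range)
    (fun α v hv ↦ hf.invariant α x ▸ Submodule.mem_map_of_mem hv) ?_ hy hyV (α := α) ?_ β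
    _ ⟨Z, rfl⟩
  · exact (mul_eq_zero.1 h).resolve_left (inv_ne_zero (four_mul_add_adjSign_ne_zero β hn))
  · rintro _ ⟨u, rfl⟩ hu
    exact (congrArg _ (hf.nondegenerate x u fun v ↦ hu _ ⟨v, rfl⟩)).trans (map_zero _)
  · rintro _ ⟨u, rfl⟩
    exact mul_eq_zero_of_right _ (hα u)

/-- `F_α`, `g` and `J_α` all restrict. The normalising constant is still that of the ambient
dimension, which is what produces the ratios in `leeForm_induced`. -/
theorem F_induced_eq_modelTensor (hf : S.IsHolomorphicImmersion E f) {n : ℕ}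
    (hS : S.IsWManifold n) (α : Fin 3) (x : M) (X Y Z : TangentSpace 𝓘(ℝ, E) x) :
    hf.induced.F α x X Y Z = hf.induced.modelTensor α x ((4 * (n : ℝ) + adjSign α - 1)⁻¹ •
      (S.leeLinear α (f x) ∘ₗ (mfderiv 𝓘(ℝ, E) 𝓘(ℝ, E') f x).toLinearMap)) X Y Z := by
  rw [hf.F_induced, hS.F_eq_modelTensor]
  simp [modelTensor, val_induced, mfderiv_J]

theorem leeForm_induced (hf : S.IsHolomorphicImmersion E f) {m n : ℕ}
    (hm : Module.finrank ℝ E = 4 * m) (hS : S.IsWManifold n) (α : Fin 3) (x : M)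
    (Z : TangentSpace 𝓘(ℝ, E) x) :
    hf.induced.leeForm α x Z = (4 * (m : ℝ) + adjSign α - 1) * (4 * (n : ℝ) + adjSign α - 1)⁻¹ *
      S.leeForm α (f x) (mfderiv 𝓘(ℝ, E) 𝓘(ℝ, E') f x Z) := by
  rw [leeForm_eq_of_modelTensor (hf.F_induced_eq_modelTensor hS α x), hm]
  simp [mul_assoc]

theorem induced_F_eq_modelTensor_leeLinear (hf : S.IsHolomorphicImmersion E f) {m n : ℕ}
    (hm : Module.finrank ℝ E = 4 * m) (hS : S.IsWManifold n) (α : Fin 3) (x : M)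
    (X Y Z : TangentSpace 𝓘(ℝ, E) x) :
    hf.induced.F α x X Y Z = hf.induced.modelTensor α x
      ((4 * (m : ℝ) + adjSign α - 1)⁻¹ • hf.induced.leeLinear α x) X Y Z := by
  -- For `m = 0` and `α ≠ 0` the factor `4m + ε - 1` is zero and cannot be cancelled, but then the
  -- tangent space is trivial.
  rcases eq_or_ne m 0 with rfl | hm0
  · have : Subsingleton (TangentSpace 𝓘(ℝ, E) x) :=
      Module.finrank_zero_iff.1 ((finrank_eq_of_tangent x).trans (by simpa using hm))
    rw [Subsingleton.elim X 0]
    simp [F, modelTensor]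
  · rw [hf.F_induced_eq_modelTensor hS]
    congr 1
    ext W
    simp only [LinearMap.smul_apply, leeLinear_apply, hf.leeForm_induced hm hS, smul_eq_mul,
      LinearMap.comp_apply, ContinuousLinearMap.coe_coe]
    rw [mul_assoc, inv_mul_cancel_left₀ (four_mul_add_adjSign_ne_zero α hm0)]

/-- A holomorphic submanifold of a `𝒲`-manifold is a `𝒲`-manifold. -/
theorem isWManifold_induced (hf : S.IsHolomorphicImmersion E f) {m n : ℕ}
    (hm : Module.finrank ℝ E = 4 * m) (hS : S.IsWManifold n) : hf.induced.IsWManifold m where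
  finrank_eq := hm
  hypercomplex α X Y x hX hY := hf.nijenhuis_induced α (hS.hypercomplex α) hX hY
  F_one x X Y Z := by
    rw [hf.induced_F_eq_modelTensor_leeLinear hm hS]
    have : (4 * (m : ℝ) + -1 - 1) = 2 * (2 * m - 1) := by ring
    simp only [modelTensor, adjSign, if_true, LinearMap.smul_apply, leeLinear_apply, smul_eq_mul,
      this]
    ring
  F_two_three α hα x X Y Z := by
    rw [hf.induced_F_eq_modelTensor_leeLinear hm hS]
    have : (4 * (m : ℝ) + 1 - 1) = 4 * m := by ring
    simp only [modelTensor, adjSign, hα, if_false, LinearMap.smul_apply, leeLinear_apply,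
      smul_eq_mul, this]
    ring

/-- Parallel `J_α` makes the Lee form of `M` vanish, and this is a nonzero multiple of the
restricted ambient one when `m ≠ 0`. Conversely, a model tensor with zero form is zero. -/
theorem isKManifold_induced_iff (hf : S.IsHolomorphicImmersion E f) {m n : ℕ}
    (hm : Module.finrank ℝ E = 4 * m) (hS : S.IsWManifold n) :
    hf.induced.IsKManifold ↔ ∀ (α : Fin 3) (x : M) (Z : TangentSpace 𝓘(ℝ, E) x),
      S.leeForm α (f x) (mfderiv 𝓘(ℝ, E) 𝓘(ℝ, E') f x Z) = 0 := by
  constructor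
  · intro hK α x Z
    rcases eq_or_ne m 0 with rfl | hm0
    · have : Subsingleton (TangentSpace 𝓘(ℝ, E) x) :=
        Module.finrank_zero_iff.1 ((finrank_eq_of_tangent x).trans (by simpa using hm))
      rw [Subsingleton.elim Z 0, map_zero]
      exact map_zero (S.leeLinear α (f x))
    -- Injectivity of `df` gives `m ≤ n`, hence `n ≠ 0`.
    · have hn0 : n ≠ 0 := by
        have h1 := LinearMap.finrank_le_finrank_of_injective
          (f := (mfderiv 𝓘(ℝ, E) 𝓘(ℝ, E') f x).toLinearMap) (hf.injective_mfderiv x)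
        have h2 : Module.finrank ℝ E ≤ Module.finrank ℝ E' := h1
        rw [hm, hS.finrank_eq] at h2
        omega
      have h0 : hf.induced.leeForm α x Z = 0 := by
        simp [leeForm, PseudoRiemannianMetric.contract, F, hK α x]
      rw [hf.leeForm_induced hm hS] at h0
      exact (mul_eq_zero.1 h0).resolve_left (mul_ne_zero (four_mul_add_adjSign_ne_zero α hm0)
        (inv_ne_zero (four_mul_add_adjSign_ne_zero α hn0)))
  · intro h α x
    ext Y X
    refine hf.induced.g.nondegenerate x _ fun Z ↦ ?_
    refine (hf.F_induced_eq_modelTensor hS α x X Y Z).trans ?_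
    simp [modelTensor, h]

end HermitianNordenStructure.IsHolomorphicImmersion

end

/-! ### The main theorem -/

theorem theorem3p2
    {E : Type*} [NormedAddCommGroup E] [NormedSpace ℝ E] [FiniteDimensional ℝ E]
    {M : Type*} [TopologicalSpace M] [ChartedSpace E M] [IsManifold 𝓘(ℝ, E) ∞ M]
    {E' : Type*} [NormedAddCommGroup E'] [NormedSpace ℝ E'] [FiniteDimensional ℝ E']
    {N : Type*} [TopologicalSpace N] [ChartedSpace E' N] [IsManifold 𝓘(ℝ, E') ∞ N]
    (m n : ℕ) (hmn : m < n) (hm : Module.finrank ℝ E = 4 * m)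
    (S : HermitianNordenStructure E' N) (hS : S.IsWManifold n)
    (f : M → N) (hf : S.IsHolomorphicImmersion E f) :
    -- `M` always satisfies the defining conditions of the class `𝒲`
    hf.induced.IsWManifold m ∧
    -- `M` is a `𝒲`-manifold (and not a `𝒦`-manifold) iff no Lee form of `N` vanishes on `TM`
    ((hf.induced.IsWManifold m ∧ ¬ hf.induced.IsKManifold) ↔
      ∀ α : Fin 3, ∃ (x : M) (Z : TangentSpace 𝓘(ℝ, E) x),
        S.leeForm α (f x) (mfderiv 𝓘(ℝ, E) 𝓘(ℝ, E') f x Z) ≠ 0) ∧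
    -- `M` is a `𝒦`-manifold iff all Lee forms of `N` vanish on `TM`
    (hf.induced.IsKManifold ↔
      ∀ (α : Fin 3) (x : M) (Z : TangentSpace 𝓘(ℝ, E) x),
        S.leeForm α (f x) (mfderiv 𝓘(ℝ, E) 𝓘(ℝ, E') f x Z) = 0) ∧
    -- the Lee forms of `M` and of `N`
    (∀ (x : M) (Z : TangentSpace 𝓘(ℝ, E) x),
      hf.induced.leeForm 0 x Z = (2 * (m : ℝ) - 1) / (2 * (n : ℝ) - 1) *
        S.leeForm 0 (f x) (mfderiv 𝓘(ℝ, E) 𝓘(ℝ, E') f x Z)) ∧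
    (∀ (α : Fin 3), α ≠ 0 → ∀ (x : M) (Z : TangentSpace 𝓘(ℝ, E) x),
      hf.induced.leeForm α x Z = (m : ℝ) / (n : ℝ) *
        S.leeForm α (f x) (mfderiv 𝓘(ℝ, E) 𝓘(ℝ, E') f x Z)) := by
  have hdim : Module.finrank ℝ E < Module.finrank ℝ E' := by
    have := hS.finrank_eq
    omega
  have hW := hf.isWManifold_induced hm hS
  have hK := hf.isKManifold_induced_iff hm hS
  refine ⟨hW, ⟨fun h α ↦ ?_, fun h ↦ ⟨hW, fun hK' ↦ ?_⟩⟩, hK, fun x Z ↦ ?_, fun α hα x Z ↦ ?_⟩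
  · have hne := mt hK.2 h.2
    push Not at hne
    obtain ⟨β, x, Z, hZ⟩ := hne
    -- The point where one Lee form is nonzero on the tangent space serves for every `α`, because
    -- `leeForm_vanish` is pointwise.
    refine ⟨x, ?_⟩
    by_contra! hα
    exact hZ (hf.leeForm_vanish hS hdim hα β Z)
  · obtain ⟨x, Z, hZ⟩ := h 0
    exact hZ (hK.1 hK' 0 x Z)
  · have e1 : (4 * (m : ℝ) + -1 - 1) = 2 * (2 * m - 1) := by ring
    have e2 : (4 * (n : ℝ) + -1 - 1) = 2 * (2 * n - 1) := by ring
    rw [hf.leeForm_induced hm hS]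
    simp only [HermitianNordenStructure.adjSign, if_true, e1, e2]
    rw [← div_eq_mul_inv, mul_div_mul_left _ _ two_ne_zero]
  · have e1 : (4 * (m : ℝ) + 1 - 1) = 4 * m := by ring
    have e2 : (4 * (n : ℝ) + 1 - 1) = 4 * n := by ring
    rw [hf.leeForm_induced hm hS]
    simp only [HermitianNordenStructure.adjSign, hα, if_false, e1, e2]
    rw [← div_eq_mul_inv, mul_div_mul_left _ _ four_ne_zero]
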